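/- Let $n\ge 1$, $1<m<\infty$ and $m'=m/(m-1)$; functions on $\mathbb R^n$ are real- or complex-valued. Let $T$ be a linear operator that is bounded on $L^p(\mathbb R^n)$ for every $p\in(m',\infty)$ (the operators on the different $L^p$ agreeing on common functions), and that has an integral kernel $K(x,y)$, measurable in $y$, in the following sense: for every bounded function $f$ with compact support, $$Tf(x)=\int_{\mathbb R^n}K(x,y)f(y)\,dy\quad\text{(absolutely convergent) for a.e. }x\notin\operatorname{supp}f .$$ Suppose that $K$ satisfies $H(m)$: there is a constant $C>0$ such that for all $l>0$ and all $x,x_0\in\mathbb R^n$ with $|x-x_0|\le l$, $$\sum_{k=5}^\infty k\,(2^kl)^{n/m'}\Big(\int_{2^kl\le|y-x_0|<2^{k+1}l}|K(x,y)-K(x_0,y)|^m\,dy\Big)^{1/m}<C .$$ For a locally integrable $g$ put $M^\sharp g(x)=\sup_{B\ni x}\frac1{|B|}\int_B|g(y)-g_B|\,dy$, where the supremum is over all balls $B$ containing $x$ and $g_B=\frac1{|B|}\int_B g$; let $\|g\|_{\mathrm{BMO}}=\|M^\sharp g\|_\infty$, and let $\mathrm{BMO}$ be the set of $g\in L^1_{loc}(\mathbb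 R^n)$ with $\|g\|_{\mathrm{BMO}}<\infty$. Let $M$ be the Hardy–Littlewood maximal function (supremum of averages over the balls containing $x$), and $M_sg=M(|g|^s)^{1/s}$. The commutator is $[b,T]f=b\,Tf-T(bf)$; it is defined for those $f\in\bigcup_{m'<p<\infty}L^p$ for which $bf\in\bigcup_{m'<q<\infty}L^q$. Then: 1. If $b\in\mathrm{BMO}$ and $f$ is bounded with compact support, then $bf\in L^q$ for every $q\in(m',\infty)$; so $[b,T]$ is defined on the bounded functions with compact support, which are dense in each $L^p$, $p\in(m',\infty)$. 2. For every $p\in(m',\infty)$ there is a constant $C_p$ such that for every $b\in\mathrm{BMO}$ the commutator is bounded on $L^p$ with norm at most $C_p\|b\|_{\mathrm{BMO}}$: there is a linear operator $S$ on $L^p$ with $\|Sf\|_p\le C_p\|b\|_{\mathrm{BMO}}\|f\|_p$ for all $f\in L^p$, and $Sf=[b,T]f$ a.e. for every $f\in L^p$ for which $[b,T]f$ is defined. 3. For every $s>m'$ there is a constant $C_s$ such that for every $b\in\mathrm{BMO}$, every $f$ for which $[b,T]f$ is defined, and every $x\in\mathbb R^n$, $$M^\sharp([b,T]f)(x)\le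 C_s\|b\|_{\mathrm{BMO}}\big(M_s(Tf)(x)+M_sf(x)\big).$$ The constants $C_p$ and $C_s$ do not depend on $b$, $f$ or $x$. -/

import Mathlib

open MeasureTheory
open scoped ENNReal NNReal

namespace CommutatorBMO

/-- `ℝⁿ` with the Euclidean norm and Lebesgue measure. -/
abbrev Rn (n : ℕ) : Type := EuclideanSpace ℝ (Fin n)

/-- The Hardy-Littlewood maximal function of a nonnegative function `g`: the supremum of the
averages of `g` over all balls that contain `x`. -/
noncomputable def maximal {n : ℕ} (g : Rn n → ℝ≥0∞) (x : Rn n) : ℝ≥0∞ :=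
  ⨆ (c : Rn n) (r : ℝ) (_ : x ∈ Metric.ball c r), ⨍⁻ y in Metric.ball c r, g y ∂volume

/-- `M_s f = (M (|f| ^ s)) ^ (1 / s)`. -/
noncomputable def maximalPow {n : ℕ} {𝕜 : Type*} [RCLike 𝕜] (s : ℝ) (f : Rn n → 𝕜)
    (x : Rn n) : ℝ≥0∞ :=
  (maximal (fun y => ‖f y‖ₑ ^ s) x) ^ (1 / s)

/-- The sharp function of Fefferman and Stein: the supremum over all balls `B` that contain `x` of
the average over `B` of `|f - f_B|`, where `f_B` is the average of `f` over `B`. -/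
noncomputable def sharp {n : ℕ} {𝕜 : Type*} [RCLike 𝕜] (f : Rn n → 𝕜) (x : Rn n) : ℝ≥0∞ :=
  ⨆ (c : Rn n) (r : ℝ) (_ : x ∈ Metric.ball c r),
    ⨍⁻ y in Metric.ball c r, ‖f y - ⨍ z in Metric.ball c r, f z ∂volume‖ₑ ∂volume

/-- The BMO norm: the `L^∞` norm of the sharp function. -/
noncomputable def bmoNorm {n : ℕ} {𝕜 : Type*} [RCLike 𝕜] (f : Rn n → 𝕜) : ℝ≥0∞ :=
  essSup (sharp f) volume

/-- Functions of bounded mean oscillation. -/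
def IsBMO {n : ℕ} {𝕜 : Type*} [RCLike 𝕜] (f : Rn n → 𝕜) : Prop :=
  LocallyIntegrable f volume ∧ bmoNorm f < ∞

/-- Bounded functions with compact support, the class `L_c^∞`. -/
def IsBddCompact {n : ℕ} {𝕜 : Type*} [RCLike 𝕜] (f : Rn n → 𝕜) : Prop :=
  MemLp f ∞ volume ∧ HasCompactSupport f

/-- `T` restricts to a linear operator from `L^p` to `L^p` of norm at most `C`. Operators act on
functions; linearity is up to null sets. (It follows that `T f` depends, up to null sets, only on
the a.e. class of `f ∈ L^p`.) Nothing is said about `T f` for `f ∉ L^p`. -/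
structure IsLpBoundedBy {n : ℕ} {𝕜 : Type*} [RCLike 𝕜] (T : (Rn n → 𝕜) → (Rn n → 𝕜))
    (p : ℝ≥0∞) (C : ℝ≥0∞) : Prop where
  add : ∀ f g : Rn n → 𝕜, MemLp f p volume → MemLp g p volume →
    T (f + g) =ᵐ[volume] T f + T g
  smul : ∀ (a : 𝕜) (f : Rn n → 𝕜), MemLp f p volume → T (a • f) =ᵐ[volume] a • T f
  memLp : ∀ f : Rn n → 𝕜, MemLp f p volume → MemLp (T f) p volume
  bound : ∀ f : Rn n → 𝕜, MemLp f p volume → eLpNorm (T f) p volume ≤ C * eLpNorm f p volume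

/-- `T` is a bounded linear operator on `L^p`. -/
def IsLpBounded {n : ℕ} {𝕜 : Type*} [RCLike 𝕜] (T : (Rn n → 𝕜) → (Rn n → 𝕜))
    (p : ℝ≥0∞) : Prop :=
  ∃ C : ℝ≥0, IsLpBoundedBy T p C

/-- `T` is an integral operator with the (possibly singular) kernel `K`: for every bounded
compactly supported `f`, `T f x = ∫ K x y * f y dy`, absolutely convergent, for almost every `x`
outside the support of `f`. -/
structure HasKernel {n : ℕ} {𝕜 : Type*} [RCLike 𝕜] (T : (Rn n → 𝕜) → (Rn n → 𝕜))
    (K : Rn n → Rn n → 𝕜) : Prop where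
  meas : ∀ x, AEStronglyMeasurable (K x) volume
  repr : ∀ f : Rn n → 𝕜, IsBddCompact f → ∀ᵐ x ∂volume, x ∉ tsupport f →
    Integrable (fun y => K x y * f y) volume ∧ T f x = ∫ y, K x y * f y

/-- The smoothness condition `H(m)` in the first variable, for `m ≥ 1`; the sum over `k ≥ 5` is
written with `k + 5` in place of `k`, and `n / m' = n * (1 - 1 / m)`. -/
def HCond {n : ℕ} {𝕜 : Type*} [RCLike 𝕜] (m : ℝ) (K : Rn n → Rn n → 𝕜) : Prop :=
  ∃ C : ℝ≥0, ∀ (l : ℝ) (x x₀ : Rn n), 0 < l → ‖x - x₀‖ ≤ l →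
    ∑' k : ℕ, ((k + 5 : ℕ) : ℝ≥0∞) *
        ENNReal.ofReal (((2 : ℝ) ^ (k + 5) * l) ^ ((n : ℝ) * (1 - 1 / m))) *
        (∫⁻ y in {y : Rn n | (2 : ℝ) ^ (k + 5) * l ≤ ‖y - x₀‖ ∧
            ‖y - x₀‖ < (2 : ℝ) ^ (k + 5 + 1) * l}, ‖K x y - K x₀ y‖ₑ ^ m) ^ (1 / m)
      < (C : ℝ≥0∞)

/-- The commutator `[b, T] f = b T f - T (b f)`. -/
def comm {n : ℕ} {𝕜 : Type*} [RCLike 𝕜] (b : Rn n → 𝕜) (T : (Rn n → 𝕜) → (Rn n → 𝕜))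
    (f : Rn n → 𝕜) : Rn n → 𝕜 :=
  b * T f - T (b * f)

/-- The open range `(m', ∞)` of exponents, `m' = m / (m - 1)`. -/
def expRange (m : ℝ) : Set ℝ≥0∞ :=
  Set.Ioo (ENNReal.ofReal (m / (m - 1))) ∞

end CommutatorBMO

namespace CommutatorBMO

open Metric Set Filter Topology

/-! ### Balls, the maximal function, Vitali and Whitney coverings -/

section Balls

variable {n : ℕ}

/-! The heart is the pointwise bound for the sharp function. Fix a ball `B` and let `a` be the
average of `b` over it. Subtracting a constant from `b` does not change the commutator, so with
`f₁`, `f₂` the parts of `f` inside and outside `128B`, `[b,T]f = (b - a) Tf - T((b - a) f₁) - T((b -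
a) f₂)`. The first term is handled by Hölder and the `L^q` form of John-Nirenberg, the second by
boundedness of `T` on `L^t` for some `m' < t < s`. For the third, only its oscillation on `B`
matters. This is an integral of `K(z,y) - K(z₀,y)` over dyadic annuli, where Hölder with exponents
`m`, `m'` applies. The average of `b` drifts by at most a multiple of `k‖b‖` over `k` doublings,
which is exactly what the weight `k` in `H(m)` pays for. See `exists_lintegral_kernel_le` and
`exists_lintegral_comm_sub_le`.

The `L^p` bound follows from the sharp function bound, the Fefferman-Stein inequality
(`exists_lintegral_rpow_le_sharp`) and the maximal theorem, with `m' < s < p`. Fefferman-Stein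
absorbs a term, so it needs `[b,T]f ∈ L^p` in advance. This is clear for bounded `b`. A general `b`
is truncated by a Lipschitz map, which changes the BMO norm by a fixed factor only, and Fatou's
lemma removes the truncation. The operator `S` is then the `L^p` limit of the commutator along the
cut-offs of `f` to `{|b| ≤ j}`.

A recurring difficulty is that `f` and `bf` may lie in different spaces `L^p` and `L^q`, so that `bf
- af` need not lie in any space where `T` is controlled. Hence `T(bf₂)` and `T(af₂)` are kept apart,
and only their difference is compared with the kernel, by approximation (`exists_ae_kernel_bound`).

The harmonic analysis used (weak type bounds, good-`λ`, John-Nirenberg) rests on Vitali's covering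
lemma and a Whitney type covering by balls. -/

theorem volume_ball_mul (x y : Rn n) {a : ℝ} (ha : 0 < a) (r : ℝ) :
    volume (ball x (a * r)) = ENNReal.ofReal (a ^ n) * volume (ball y r) := by
  rw [Measure.addHaar_ball_mul_of_pos volume x ha r, finrank_euclideanSpace_fin,
    Measure.addHaar_ball_center volume y r]

theorem volume_ball_ne_zero (c : Rn n) {r : ℝ} (hr : 0 < r) : volume (ball c r) ≠ 0 :=
  (measure_ball_pos volume c hr).ne'

theorem volume_ball_ne_top (c : Rn n) (r : ℝ) : volume (ball c r) ≠ ∞ := measure_ball_lt_top.ne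

theorem pos_of_mem_ball {x c : Rn n} {r : ℝ} (h : x ∈ ball c r) : 0 < r :=
  dist_nonneg.trans_lt (mem_ball.1 h)

/-- Radii of balls of bounded measure are bounded. -/
theorem exists_radius_bound [NeZero n] {A : ℝ≥0∞} (hA : A ≠ ∞) :
    ∃ R : ℝ, ∀ (c : Rn n) (r : ℝ), volume (ball c r) ≤ A → r ≤ R := by
  have h1 := volume_ball_ne_zero (0 : Rn n) one_pos
  have h2 := volume_ball_ne_top (0 : Rn n) 1
  refine ⟨max 1 (A / volume (ball (0 : Rn n) 1)).toReal, fun c r h => ?_⟩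
  by_contra! hr
  obtain ⟨hr1, hr2⟩ := max_lt_iff.1 hr
  have h3 : volume (ball c r) = ENNReal.ofReal (r ^ n) * volume (ball (0 : Rn n) 1) := by
    simpa using volume_ball_mul c (0 : Rn n) (by linarith : (0 : ℝ) < r) 1
  rw [h3, ← ENNReal.le_div_iff_mul_le (Or.inl h1) (Or.inl h2)] at h
  have h4 : r ≤ r ^ n := le_self_pow₀ hr1.le (NeZero.ne n)
  have h5 := ENNReal.toReal_mono (ENNReal.div_ne_top hA h1) h
  rw [ENNReal.toReal_ofReal (by positivity)] at h5
  linarith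

theorem setLIntegral_ball_le_maximal (g : Rn n → ℝ≥0∞) {x c : Rn n} {r : ℝ} (h : x ∈ ball c r) :
    ∫⁻ y in ball c r, g y ≤ maximal g x * volume (ball c r) := by
  have h1 : ⨍⁻ y in ball c r, g y ∂volume ≤ maximal g x :=
    le_iSup_of_le c (le_iSup_of_le r (le_iSup_of_le h le_rfl))
  rw [← measure_mul_setLAverage g (volume_ball_ne_top c r), mul_comm]
  gcongr

theorem exists_ball_of_lt_maximal {g : Rn n → ℝ≥0∞} {x : Rn n} {t : ℝ≥0∞} (h : t < maximal g x) :
    ∃ c r, x ∈ ball c r ∧ t * volume (ball c r) < ∫⁻ y in ball c r, g y := by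
  simp only [maximal, lt_iSup_iff] at h
  obtain ⟨c, r, hx, h⟩ := h
  refine ⟨c, r, hx, ?_⟩
  rwa [setLAverage_eq, ENNReal.lt_div_iff_mul_lt (Or.inl (volume_ball_ne_zero c (pos_of_mem_ball hx)))
    (Or.inl (volume_ball_ne_top c r))] at h

theorem lt_maximal_of_ball {g : Rn n → ℝ≥0∞} {x c : Rn n} {r : ℝ} {t : ℝ≥0∞} (hx : x ∈ ball c r)
    (h : t * volume (ball c r) < ∫⁻ y in ball c r, g y) : t < maximal g x := by
  simp only [maximal, lt_iSup_iff]
  refine ⟨c, r, hx, ?_⟩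
  rwa [setLAverage_eq, ENNReal.lt_div_iff_mul_lt (Or.inl (volume_ball_ne_zero c (pos_of_mem_ball hx)))
    (Or.inl (volume_ball_ne_top c r))]

theorem isOpen_lt_maximal (g : Rn n → ℝ≥0∞) (t : ℝ≥0∞) : IsOpen {x | t < maximal g x} := by
  rw [isOpen_iff_mem_nhds]
  intro x hx
  obtain ⟨c, r, hxc, h⟩ := exists_ball_of_lt_maximal hx
  exact Filter.mem_of_superset (isOpen_ball.mem_nhds hxc) fun y hy => lt_maximal_of_ball hy h

theorem measurable_maximal (g : Rn n → ℝ≥0∞) : Measurable (maximal g) :=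
  measurable_of_Ioi fun t => (isOpen_lt_maximal g t).measurableSet

theorem maximal_mono {g h : Rn n → ℝ≥0∞} (hgh : g ≤ h) (x : Rn n) : maximal g x ≤ maximal h x := by
  refine iSup_mono fun c => iSup_mono fun r => iSup_mono fun _ => ?_
  exact laverage_mono_ae (ae_of_all _ hgh)

theorem maximal_add_le {g h : Rn n → ℝ≥0∞} (hg : Measurable g) (x : Rn n) :
    maximal (g + h) x ≤ maximal g x + maximal h x := by
  refine iSup_le fun c => iSup_le fun r => iSup_le fun hx => ?_
  have : ⨍⁻ y in ball c r, (g + h) y ∂volume =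
      ⨍⁻ y in ball c r, g y ∂volume + ⨍⁻ y in ball c r, h y ∂volume :=
    lintegral_add_left hg h
  rw [this]
  exact add_le_add (le_iSup_of_le c (le_iSup_of_le r (le_iSup_of_le hx le_rfl)))
    (le_iSup_of_le c (le_iSup_of_le r (le_iSup_of_le hx le_rfl)))

theorem maximal_const_le (t : ℝ≥0∞) (x : Rn n) : maximal (fun _ : Rn n => t) x ≤ t := by
  refine iSup_le fun c => iSup_le fun r => iSup_le fun hx => ?_
  rw [setLAverage_const (volume_ball_ne_zero c (pos_of_mem_ball hx)) (volume_ball_ne_top c r)]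

/-- The weak `(1,1)` inequality for the maximal function. -/
theorem mul_volume_lt_maximal_le [NeZero n] (g : Rn n → ℝ≥0∞) {t : ℝ≥0∞} (ht : t ≠ 0)
    (ht' : t ≠ ∞) :
    t * volume {x | t < maximal g x} ≤ ENNReal.ofReal (5 ^ n) * ∫⁻ y, g y := by
  by_cases hg : ∫⁻ y, g y = ∞
  · rw [hg, ENNReal.mul_top (by simp)]; exact le_top
  obtain ⟨R, hR⟩ := exists_radius_bound (n := n) (ENNReal.div_ne_top hg ht)
  let s : Set (Rn n × ℝ) := {p | 0 < p.2 ∧ t * volume (ball p.1 p.2) < ∫⁻ y in ball p.1 p.2, g y}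
  have hs : ∀ p ∈ s, p.2 ≤ R := by
    rintro ⟨c, r⟩ ⟨-, hp⟩
    apply hR c r
    rw [ENNReal.le_div_iff_mul_le (Or.inl ht) (Or.inl ht'), mul_comm]
    exact hp.le.trans (setLIntegral_le_lintegral _ _)
  -- Any enlargement factor above 3 would do. With 4 for closed balls, the open balls of factor 5
  -- cover.
  obtain ⟨u, hus, hdisj, hcov⟩ := Vitali.exists_disjoint_subfamily_covering_enlargement_closedBall
    s (fun p => p.1) (fun p => p.2) R hs 4 (by norm_num)
  have hdisj' : u.PairwiseDisjoint fun p => ball p.1 p.2 :=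
    fun p hp q hq hpq => (hdisj hp hq hpq).mono ball_subset_closedBall ball_subset_closedBall
  have hcount : u.Countable := hdisj'.countable_of_isOpen (fun _ _ => isOpen_ball)
    fun p hp => nonempty_ball.2 (hus hp).1
  have hsub : {x | t < maximal g x} ⊆ ⋃ p ∈ u, ball p.1 (5 * p.2) := by
    intro x hx
    obtain ⟨c, r, hxc, h⟩ := exists_ball_of_lt_maximal hx
    obtain ⟨q, hq, hsubq⟩ := hcov (c, r) ⟨pos_of_mem_ball hxc, h⟩
    refine mem_biUnion hq ?_
    have := hsubq (ball_subset_closedBall hxc)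
    refine closedBall_subset_ball ?_ this
    have := (hus hq).1
    linarith
  calc t * volume {x | t < maximal g x} ≤ t * ∑' p : u, volume (ball p.1.1 (5 * p.1.2)) := by
        gcongr
        exact (measure_mono hsub).trans (measure_biUnion_le volume hcount _)
    _ = ∑' p : u, ENNReal.ofReal (5 ^ n) * (t * volume (ball p.1.1 p.1.2)) := by
        rw [← ENNReal.tsum_mul_left]
        refine tsum_congr fun p => ?_
        rw [volume_ball_mul p.1.1 p.1.1 (by norm_num : (0 : ℝ) < 5)]
        ring
    _ ≤ ∑' p : u, ENNReal.ofReal (5 ^ n) * ∫⁻ y in ball p.1.1 p.1.2, g y := by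
        gcongr with p
        exact (hus p.2).2.le
    _ = ENNReal.ofReal (5 ^ n) * ∫⁻ y in ⋃ p ∈ u, ball p.1 p.2, g y := by
        rw [ENNReal.tsum_mul_left, lintegral_biUnion hcount (fun _ _ => measurableSet_ball) hdisj']
    _ ≤ _ := mul_le_mul_right (setLIntegral_le_lintegral _ _) _

/-- A Whitney type covering of an open set of finite measure by balls. -/
theorem exists_whitney_cover [NeZero n] {E : Set (Rn n)} (hE : IsOpen E) (hEfin : volume E ≠ ∞) :
    ∃ u : Set (Rn n × ℝ), u.Countable ∧ (∀ p ∈ u, 0 < p.2 ∧ ball p.1 p.2 ⊆ E ∧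
      ∃ z ∉ E, dist z p.1 < 11 * p.2) ∧ (u.PairwiseDisjoint fun p => ball p.1 p.2) ∧
      E ⊆ ⋃ p ∈ u, ball p.1 (5 * p.2) := by
  -- The whole space has infinite measure, so `E` omits a point and the distance to the complement
  -- is meaningful.
  have hne : Eᶜ.Nonempty := by
    rw [nonempty_compl]
    rintro rfl
    apply hEfin
    exact measure_univ_of_isAddLeftInvariant volume
  obtain ⟨R, hR⟩ := exists_radius_bound (n := n) hEfin
  -- With a tenth of the distance, each ball lies in `E` while its 11-fold enlargement meets the
  -- complement; 11 exceeds 10 because the infimum need not be used as attained.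
  let d : Rn n → ℝ := fun x => infDist x Eᶜ / 10
  have hpos : ∀ x ∈ E, 0 < d x := fun x hx => by
    have := (hE.isClosed_compl.notMem_iff_infDist_pos hne (x := x)).1 (by simpa using hx)
    positivity
  have hball : ∀ x ∈ E, ball x (d x) ⊆ E := fun x hx y hy => by
    by_contra hyE
    have h1 := infDist_le_dist_of_mem (x := x) (show y ∈ Eᶜ from hyE)
    rw [mem_ball, dist_comm] at hy
    have : infDist x Eᶜ = 10 * d x := by simp only [d]; ring
    linarith [hpos x hx]
  obtain ⟨u, hus, hdisj, hcov⟩ := Vitali.exists_disjoint_subfamily_covering_enlargement_closedBall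
    E id d R (fun x hx => hR x _ (measure_mono (hball x hx))) 4 (by norm_num)
  have hinj : InjOn (fun x => (x, d x)) u := fun x _ y _ h => (Prod.ext_iff.1 h).1
  have hdisj' : u.PairwiseDisjoint fun p => ball p (d p) :=
    fun p hp q hq hpq => (hdisj hp hq hpq).mono ball_subset_closedBall ball_subset_closedBall
  have hcount : u.Countable := hdisj'.countable_of_isOpen (fun _ _ => isOpen_ball)
    fun p hp => nonempty_ball.2 (hpos p (hus hp))
  refine ⟨(fun x => (x, d x)) '' u, hcount.image _, ?_, ?_, ?_⟩
  · rintro _ ⟨x, hx, rfl⟩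
    refine ⟨hpos x (hus hx), hball x (hus hx), ?_⟩
    have h1 : infDist x Eᶜ < 11 * d x := by
      have := hpos x (hus hx)
      have : infDist x Eᶜ = 10 * d x := by simp only [d]; ring
      linarith
    obtain ⟨z, hz, hzd⟩ := (infDist_lt_iff hne).1 h1
    exact ⟨z, hz, by rwa [dist_comm]⟩
  · rintro _ ⟨x, hx, rfl⟩ _ ⟨y, hy, rfl⟩ hxy
    exact hdisj' hx hy fun h => hxy (by rw [h])
  · intro x hx
    obtain ⟨q, hq, hsubq⟩ := hcov x hx
    rw [biUnion_image]
    refine mem_biUnion hq ?_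
    have h1 := hsubq (mem_closedBall_self (hpos x hx).le)
    refine closedBall_subset_ball ?_ h1
    linarith [hpos q (hus hq)]

/-- Lebesgue differentiation along closed balls centred at `x`, which differ from open balls by null
sets. -/
theorem enorm_ae_le_maximal [NeZero n] {𝕜 : Type*} [RCLike 𝕜] {g : Rn n → 𝕜}
    (hg : LocallyIntegrable g volume) : ∀ᵐ x, ‖g x‖ₑ ≤ maximal (fun y => ‖g y‖ₑ) x := by
  have hgn : LocallyIntegrable (fun y => ‖g y‖) volume := fun y => (hg y).norm
  filter_upwards [IsUnifLocDoublingMeasure.ae_tendsto_average (μ := (volume : Measure (Rn n)))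
    hgn 1] with x hx
  have h1 := hx (l := 𝓝[>] (0 : ℝ)) (fun _ => x) (fun r => r) tendsto_id
    (by filter_upwards [self_mem_nhdsWithin] with r hr
        exact mem_closedBall_self (by simpa using (mem_Ioi.1 hr).le))
  have h2 := (ENNReal.continuous_ofReal.tendsto _).comp h1
  rw [ofReal_norm] at h2
  refine le_of_tendsto h2 ?_
  filter_upwards [self_mem_nhdsWithin] with r hr
  have hr : 0 < r := hr
  simp only [Function.comp]
  rw [ofReal_setAverage ((hgn.integrableOn_isCompact (isCompact_closedBall x r)))
    (ae_of_all _ fun _ => norm_nonneg _)]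
  have h3 : (closedBall x r : Set (Rn n)) =ᵐ[volume] ball x r :=
    (ae_eq_of_subset_of_measure_ge ball_subset_closedBall
      (Measure.addHaar_closedBall_eq_addHaar_ball volume x r).le measurableSet_ball.nullMeasurableSet
      (by rw [Measure.addHaar_closedBall_eq_addHaar_ball volume x r]
          exact volume_ball_ne_top x r)).symm
  rw [Measure.restrict_congr_set h3, Measure.addHaar_closedBall_eq_addHaar_ball volume x r]
  rw [ENNReal.div_le_iff (volume_ball_ne_zero x hr) (volume_ball_ne_top x r)]
  simp_rw [ofReal_norm]
  exact setLIntegral_ball_le_maximal (fun y => ‖g y‖ₑ) (mem_ball_self hr)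

end Balls

/-! ### The layer cake formula with values in `[0, ∞]` -/

section LayerCake

/-- The layer cake formula at a single point: the real-valued formula for a Dirac mass gives finite
`a`, and monotonicity in `a` gives `a = ∞`. Tonelli then yields the general formula. -/
theorem setLIntegral_Ioi_rpow {q : ℝ} (hq : 0 < q) (a : ℝ≥0∞) :
    ∫⁻ t in Ioi (0 : ℝ), {t : ℝ | ENNReal.ofReal t < a}.indicator
      (fun t => ENNReal.ofReal (q * t ^ (q - 1))) t = a ^ q := by
  have key : ∀ b : ℝ≥0, ∫⁻ t in Ioi (0 : ℝ), {t : ℝ | ENNReal.ofReal t < b}.indicator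
      (fun t => ENNReal.ofReal (q * t ^ (q - 1))) t = (b : ℝ≥0∞) ^ q := by
    intro b
    have h := lintegral_rpow_eq_lintegral_meas_lt_mul (Measure.dirac ()) (f := fun _ => (b : ℝ))
      (ae_of_all _ fun _ => b.2) measurable_const.aemeasurable hq
    rw [lintegral_dirac, ← ENNReal.ofReal_rpow_of_nonneg (x := (b : ℝ)) b.2 hq.le,
      ENNReal.ofReal_coe_nnreal] at h
    rw [h, ← lintegral_const_mul' _ _ ENNReal.ofReal_ne_top]
    refine setLIntegral_congr_fun measurableSet_Ioi fun t ht => ?_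
    have ht : 0 < t := ht
    have h1 : ENNReal.ofReal t < b ↔ t < b := by
      rw [← ENNReal.ofReal_coe_nnreal, ENNReal.ofReal_lt_ofReal_iff_of_nonneg ht.le]
    by_cases htb : t < b
    · rw [indicator_of_mem (by exact h1.2 htb), ENNReal.ofReal_mul hq.le]
      simp [htb]
    · rw [indicator_of_notMem (by exact fun h => htb (h1.1 h))]
      simp [htb]
  induction a using ENNReal.recTopCoe with
  | coe b => exact key b
  | top =>
    rw [ENNReal.top_rpow_of_pos hq]
    refine ENNReal.eq_top_of_forall_nnreal_le fun r => ?_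
    have h1 : (r : ℝ≥0∞) = ((r ^ (1 / q) : ℝ≥0) : ℝ≥0∞) ^ q := by
      rw [← ENNReal.coe_rpow_of_nonneg _ hq.le, ← NNReal.rpow_mul, one_div_mul_cancel hq.ne',
        NNReal.rpow_one]
    rw [h1, ← key]
    refine lintegral_mono fun t => ?_
    refine indicator_le_indicator_of_subset (fun t ht => ?_) (fun _ => zero_le) t
    exact ENNReal.ofReal_lt_top

theorem measurable_lt_indicator {X : Type*} [MeasurableSpace X] {F : X → ℝ≥0∞}
    (hF : Measurable F) {φ : ℝ → ℝ≥0∞} (hφ : Measurable φ) :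
    Measurable fun z : X × ℝ => {t : ℝ | ENNReal.ofReal t < F z.1}.indicator φ z.2 := by
  have : (fun z : X × ℝ => {t : ℝ | ENNReal.ofReal t < F z.1}.indicator φ z.2) =
      {z : X × ℝ | ENNReal.ofReal z.2 < F z.1}.indicator fun z => φ z.2 := by
    ext z; simp [indicator_apply]
  rw [this]
  exact (hφ.comp measurable_snd).indicator
    (measurableSet_lt (ENNReal.measurable_ofReal.comp measurable_snd) (hF.comp measurable_fst))

/-- The layer cake formula for functions with values in `[0, ∞]`. -/
theorem lintegral_rpow_layercake {X : Type*} [MeasurableSpace X] (μ : Measure X) [SFinite μ]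
    {F : X → ℝ≥0∞} (hF : Measurable F) {q : ℝ} (hq : 0 < q) :
    ∫⁻ x, F x ^ q ∂μ = ∫⁻ t in Ioi (0 : ℝ), ENNReal.ofReal (q * t ^ (q - 1)) *
      μ {x | ENNReal.ofReal t < F x} := by
  simp_rw [← setLIntegral_Ioi_rpow hq]
  rw [lintegral_lintegral_swap (measurable_lt_indicator hF
    (φ := fun t => ENNReal.ofReal (q * t ^ (q - 1))) (by fun_prop)).aemeasurable]
  refine lintegral_congr fun t => ?_
  have : ∀ x, {t : ℝ | ENNReal.ofReal t < F x}.indicator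
      (fun t => ENNReal.ofReal (q * t ^ (q - 1))) t =
      {x | ENNReal.ofReal t < F x}.indicator (fun _ => ENNReal.ofReal (q * t ^ (q - 1))) x := by
    intro x; simp [indicator_apply]
  simp_rw [this]
  rw [lintegral_indicator_const (measurableSet_lt measurable_const hF)]

end LayerCake

/-! ### The Hardy-Littlewood maximal theorem -/

section Maximal

variable {n : ℕ}

theorem maximal_congr_ae {g h : Rn n → ℝ≥0∞} (hgh : g =ᵐ[volume] h) : maximal g = maximal h := by
  ext x
  refine iSup_congr fun c => iSup_congr fun r => iSup_congr fun _ => ?_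
  exact laverage_congr (ae_restrict_of_ae hgh)

/-- The Hardy-Littlewood maximal theorem. -/
theorem exists_lintegral_maximal_rpow_le [NeZero n] {p : ℝ} (hp : 1 < p) :
    ∃ C : ℝ≥0, ∀ g : Rn n → ℝ≥0∞, AEMeasurable g volume →
      ∫⁻ x, maximal g x ^ p ≤ C * ∫⁻ x, g x ^ p := by
  have hp0 : 0 < p := by linarith
  have hp1 : 0 < p - 1 := by linarith
  refine ⟨(2 : ℝ≥0) ^ p * (Real.toNNReal (5 ^ n) * Real.toNNReal (p / (p - 1))),
    fun g hg => ?_⟩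
  obtain ⟨g', hg', hgg'⟩ := hg
  rw [maximal_congr_ae hgg', lintegral_congr_ae (hgg'.mono fun x hx => show g x ^ p = g' x ^ p by rw [hx])]
  clear hgg' g
  have hM : Measurable fun x => maximal g' x / 2 := (measurable_maximal g').div_const 2
  have h1 : ∀ x, maximal g' x ^ p = 2 ^ p * (maximal g' x / 2) ^ p := by
    intro x
    rw [← ENNReal.mul_rpow_of_nonneg _ _ hp0.le, ENNReal.mul_div_cancel (by norm_num) (by norm_num)]
  have hweak : ∀ t : ℝ, 0 < t → ENNReal.ofReal (p * t ^ (p - 1)) *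
      volume {x | ENNReal.ofReal t < maximal g' x / 2} ≤
      ENNReal.ofReal (5 ^ n) * ENNReal.ofReal (p / (p - 1)) * ∫⁻ x, g' x *
        {t : ℝ | ENNReal.ofReal t < g' x}.indicator
        (fun t => ENNReal.ofReal ((p - 1) * t ^ (p - 1 - 1))) t := by
    intro t ht
    have htE : ENNReal.ofReal t ≠ 0 := by simpa using ht
    set S : Set (Rn n) := {x | ENNReal.ofReal t < g' x} with hS
    have hSm : MeasurableSet S := measurableSet_lt measurable_const hg'
    -- Marcinkiewicz truncation: `g'` is at most its restriction to `S` plus `t`, so if `M g'`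
    -- exceeds `2t` then the maximal function of the restriction exceeds `t`.
    have hsub : {x | ENNReal.ofReal t < maximal g' x / 2} ⊆
        {x | ENNReal.ofReal t < maximal (S.indicator g') x} := by
      intro x hx
      have hx : ENNReal.ofReal t < maximal g' x / 2 := hx
      rw [ENNReal.lt_div_iff_mul_lt (by simp) (by simp)] at hx
      by_contra hcon
      have hcon : maximal (S.indicator g') x ≤ ENNReal.ofReal t := not_lt.1 hcon
      have h2 : maximal g' x ≤ maximal (S.indicator g') x + ENNReal.ofReal t := by
        calc maximal g' x ≤ maximal (S.indicator g' + fun _ => ENNReal.ofReal t) x := by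
              refine maximal_mono (fun y => ?_) x
              by_cases hy : y ∈ S
              · simp [hy]
              · simp only [Pi.add_apply, indicator_of_notMem hy, zero_add]
                exact not_lt.1 hy
          _ ≤ _ := (maximal_add_le (hg'.indicator hSm) x).trans
              (add_le_add le_rfl (maximal_const_le _ x))
      have := hx.trans_le (h2.trans (add_le_add hcon le_rfl))
      rw [mul_two] at this
      exact lt_irrefl _ this
    have h3 := mul_volume_lt_maximal_le (S.indicator g') htE ENNReal.ofReal_ne_top
    -- One factor `t` is spent on the weak type inequality; what remains is the layer cake weight of
    -- exponent `p - 1`.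
    have h4 : ENNReal.ofReal (p * t ^ (p - 1)) = ENNReal.ofReal (p / (p - 1)) *
        ENNReal.ofReal ((p - 1) * t ^ (p - 1 - 1)) * ENNReal.ofReal t := by
      rw [← ENNReal.ofReal_mul (by positivity), ← ENNReal.ofReal_mul (by positivity)]
      congr 1
      rw [Real.rpow_sub_one ht.ne' (p - 1)]
      field_simp
    have h5 : ∀ x, g' x * {t : ℝ | ENNReal.ofReal t < g' x}.indicator
        (fun t => ENNReal.ofReal ((p - 1) * t ^ (p - 1 - 1))) t =
        ENNReal.ofReal ((p - 1) * t ^ (p - 1 - 1)) * S.indicator g' x := by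
      intro x
      by_cases hx : ENNReal.ofReal t < g' x
      · rw [indicator_of_mem (by exact hx), indicator_of_mem (by exact hx), mul_comm]
      · rw [indicator_of_notMem (by exact hx), indicator_of_notMem (by exact hx)]; simp
    simp_rw [h5]
    rw [lintegral_const_mul' _ _ ENNReal.ofReal_ne_top, h4]
    calc _ ≤ ENNReal.ofReal (p / (p - 1)) * ENNReal.ofReal ((p - 1) * t ^ (p - 1 - 1)) *
          (ENNReal.ofReal t * volume {x | ENNReal.ofReal t < maximal (S.indicator g') x}) := by
          rw [mul_assoc (_ * _)]
          gcongr
      _ ≤ ENNReal.ofReal (p / (p - 1)) * ENNReal.ofReal ((p - 1) * t ^ (p - 1 - 1)) *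
          (ENNReal.ofReal (5 ^ n) * ∫⁻ y, S.indicator g' y) := by gcongr
      _ = _ := by ring
  simp_rw [h1]
  rw [lintegral_const_mul' _ _ (by simp), lintegral_rpow_layercake volume hM hp0]
  have h6 : ∫⁻ t in Ioi (0 : ℝ), ENNReal.ofReal (p * t ^ (p - 1)) *
      volume {x | ENNReal.ofReal t < maximal g' x / 2} ≤
      ENNReal.ofReal (5 ^ n) * ENNReal.ofReal (p / (p - 1)) * ∫⁻ x, g' x ^ p := by
    refine (setLIntegral_mono' measurableSet_Ioi fun t ht => hweak t ht).trans ?_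
    rw [lintegral_const_mul' _ _ (by finiteness)]
    refine mul_le_mul_right ?_ _
    rw [lintegral_lintegral_swap]
    · refine lintegral_mono fun x => ?_
      have hmeas : Measurable fun t : ℝ => {t : ℝ | ENNReal.ofReal t < g' x}.indicator
          (fun t => ENNReal.ofReal ((p - 1) * t ^ (p - 1 - 1))) t :=
        (measurable_lt_indicator hg' (φ := fun t => ENNReal.ofReal ((p - 1) * t ^ (p - 1 - 1)))
          (by fun_prop)).comp (measurable_prodMk_left (x := x))
      rw [lintegral_const_mul _ hmeas,
        setLIntegral_Ioi_rpow hp1]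
      nth_rw 1 [← ENNReal.rpow_one (g' x)]
      rw [← ENNReal.rpow_add_of_nonneg _ _ zero_le_one hp1.le, add_sub_cancel]
    · exact ((hg'.comp measurable_snd).mul ((measurable_lt_indicator hg'
        (φ := fun t => ENNReal.ofReal ((p - 1) * t ^ (p - 1 - 1)))
        (by fun_prop)).comp measurable_swap)).aemeasurable
  calc _ ≤ 2 ^ p * (ENNReal.ofReal (5 ^ n) * ENNReal.ofReal (p / (p - 1)) * ∫⁻ x, g' x ^ p) := by
        gcongr
    _ = _ := by
        push_cast
        rw [ENNReal.coe_rpow_of_nonneg _ hp0.le]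
        simp only [ENNReal.ofReal, ENNReal.coe_ofNat]
        ring

end Maximal

/-! ### The sharp function and the Fefferman-Stein inequality -/

section Sharp

variable {n : ℕ} {𝕜 : Type*} [RCLike 𝕜]

theorem setLIntegral_ball_le_sharp (f : Rn n → 𝕜) {x c : Rn n} {r : ℝ} (h : x ∈ ball c r) :
    ∫⁻ y in ball c r, ‖f y - ⨍ z in ball c r, f z‖ₑ ≤ sharp f x * volume (ball c r) := by
  have h1 : ⨍⁻ y in ball c r, ‖f y - ⨍ z in ball c r, f z‖ₑ ∂volume ≤ sharp f x :=
    le_iSup_of_le c (le_iSup_of_le r (le_iSup_of_le h le_rfl))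
  rw [← measure_mul_setLAverage _ (volume_ball_ne_top c r), mul_comm]
  gcongr

theorem sharp_le_of_forall_ball {f : Rn n → 𝕜} {x : Rn n} {t : ℝ≥0∞}
    (h : ∀ c r, x ∈ ball c r →
      ∫⁻ y in ball c r, ‖f y - ⨍ z in ball c r, f z‖ₑ ≤ t * volume (ball c r)) :
    sharp f x ≤ t := by
  refine iSup_le fun c => iSup_le fun r => iSup_le fun hx => ?_
  rw [setLAverage_eq]
  exact ENNReal.div_le_of_le_mul (h c r hx)

theorem measurable_sharp (f : Rn n → 𝕜) : Measurable (sharp f) := by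
  refine measurable_of_Ioi fun t => IsOpen.measurableSet ?_
  rw [isOpen_iff_mem_nhds]
  intro x hx
  have hx : t < sharp f x := hx
  simp only [sharp, lt_iSup_iff] at hx
  obtain ⟨c, r, hxc, h⟩ := hx
  refine Filter.mem_of_superset (isOpen_ball.mem_nhds hxc) fun y hy => ?_
  show t < sharp f y
  simp only [sharp, lt_iSup_iff]
  exact ⟨c, r, hy, h⟩

theorem enorm_setAverage_mul_le (f : Rn n → 𝕜) (c : Rn n) {r : ℝ} (hr : 0 < r) :
    ‖⨍ z in ball c r, f z‖ₑ * volume (ball c r) ≤ ∫⁻ y in ball c r, ‖f y‖ₑ := by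
  have h0 := volume_ball_ne_zero c hr
  have h1 := volume_ball_ne_top c r
  rw [setAverage_eq, enorm_smul, mul_right_comm]
  have h2 : ‖(volume.real (ball c r))⁻¹‖ₑ * volume (ball c r) = 1 := by
    rw [enorm_inv (by simp [measureReal_def, ENNReal.toReal_eq_zero_iff, h0, h1]),
      Real.enorm_of_nonneg measureReal_nonneg, ofReal_measureReal h1, ENNReal.inv_mul_cancel h0 h1]
  rw [h2, one_mul]
  exact enorm_integral_le_lintegral_enorm _

theorem enorm_setAverage_sub_mul_le {f : Rn n → 𝕜} {c : Rn n} {r : ℝ} (hr : 0 < r)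
    (hf : IntegrableOn f (ball c r) volume) (a : 𝕜) :
    ‖(⨍ z in ball c r, f z) - a‖ₑ * volume (ball c r) ≤ ∫⁻ y in ball c r, ‖f y - a‖ₑ := by
  have h0 := volume_ball_ne_zero c hr
  have h1 := volume_ball_ne_top c r
  have h : (⨍ z in ball c r, f z) - a = ⨍ z in ball c r, (f z - a) := by
    have h2 : (⨍ _z in ball c r, a) = a := setAverage_const h0 h1 a
    rw [setAverage_eq, setAverage_eq, integral_sub hf (integrableOn_const h1), smul_sub,
      ← setAverage_eq volume (fun _ => a), h2]
  rw [h]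
  exact enorm_setAverage_mul_le _ c hr

/-- The mean oscillation is at most twice the mean distance to any constant. -/
theorem setLIntegral_sub_setAverage_le {f : Rn n → 𝕜} {c : Rn n} {r : ℝ} (hr : 0 < r)
    (hf : IntegrableOn f (ball c r) volume) (a : 𝕜) :
    ∫⁻ y in ball c r, ‖f y - ⨍ z in ball c r, f z‖ₑ ≤ 2 * ∫⁻ y in ball c r, ‖f y - a‖ₑ := by
  calc _ ≤ ∫⁻ y in ball c r, (‖f y - a‖ₑ + ‖(⨍ z in ball c r, f z) - a‖ₑ) := by
        refine lintegral_mono fun y => ?_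
        have : f y - ⨍ z in ball c r, f z = (f y - a) - ((⨍ z in ball c r, f z) - a) := by ring
        rw [this]
        exact enorm_sub_le
    _ = (∫⁻ y in ball c r, ‖f y - a‖ₑ) +
        ‖(⨍ z in ball c r, f z) - a‖ₑ * volume (ball c r) := by
        rw [lintegral_add_right _ measurable_const, setLIntegral_const]
    _ ≤ _ := by
        rw [two_mul]
        gcongr
        exact enorm_setAverage_sub_mul_le hr hf a

/-- The good-`λ` inequality between the maximal function and the sharp function. -/
theorem volume_good_lambda_le [NeZero n] {g : Rn n → 𝕜} {t : ℝ≥0∞} (ht : t ≠ 0) (ht' : t ≠ ∞)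
    (hfin : volume {x | t < maximal (fun y => ‖g y‖ₑ) x} ≠ ∞) (γ : ℝ≥0∞) :
    volume ({x | (ENNReal.ofReal (17 ^ n) + 1) * t < maximal (fun y => ‖g y‖ₑ) x} ∩
      {x | sharp g x ≤ γ * t}) ≤
      ENNReal.ofReal (5 ^ n) * ENNReal.ofReal (11 ^ n) * γ *
        volume {x | t < maximal (fun y => ‖g y‖ₑ) x} := by
  set G : Rn n → ℝ≥0∞ := fun y => ‖g y‖ₑ with hG
  set A : ℝ≥0∞ := ENNReal.ofReal (17 ^ n) + 1 with hA
  set S := {x | A * t < maximal G x} ∩ {x | sharp g x ≤ γ * t} with hS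
  obtain ⟨u, hcount, hu, hdisj, hcov⟩ := exists_whitney_cover (isOpen_lt_maximal G t) hfin
  have h17 : (1 : ℝ≥0∞) ≤ ENNReal.ofReal (17 ^ n) := by
    rw [ENNReal.one_le_ofReal]; exact one_le_pow₀ (by norm_num)
  have hSsub : S ⊆ ⋃ p ∈ u, S ∩ ball p.1 (5 * p.2) := by
    intro x hx
    have : x ∈ {x | t < maximal G x} := by
      refine lt_of_le_of_lt (b := A * t) ?_ hx.1
      calc t = 1 * t := (one_mul t).symm
        _ ≤ A * t := by gcongr; exact le_add_self
    obtain ⟨p, hp, hxp⟩ := mem_iUnion₂.1 (hcov this)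
    exact mem_biUnion hp ⟨hx, hxp⟩
  have hloc : ∀ p ∈ u, volume (S ∩ ball p.1 (5 * p.2)) ≤
      ENNReal.ofReal (5 ^ n) * ENNReal.ofReal (11 ^ n) * γ * volume (ball p.1 p.2) := by
    rintro ⟨c, r⟩ hp
    obtain ⟨hr, -, z, hz, hzc⟩ := hu _ hp
    dsimp only at hr hzc ⊢
    have hz : maximal G z ≤ t := not_lt.1 hz
    rcases eq_empty_or_nonempty (S ∩ ball c (5 * r)) with he | ⟨w, hw, hwc⟩
    · rw [he]; simp
    set a := ⨍ y in ball c (11 * r), g y with ha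
    -- The enlarged ball `11B` contains the point `z` where `M g ≤ t`. This gives `|a| ≤ t`, so a
    -- large value of `M g` near the ball must come from the oscillation `h`.
    set h : Rn n → ℝ≥0∞ := (ball c (11 * r)).indicator fun y => ‖g y - a‖ₑ with hh
    have hat : ‖a‖ₑ ≤ t := by
      have h1 := enorm_setAverage_mul_le g c (r := 11 * r) (by positivity)
      have h2 := setLIntegral_ball_le_maximal G (mem_ball.2 hzc)
      have h3 := (h1.trans h2).trans (mul_le_mul_left hz _)
      exact (ENNReal.mul_le_mul_iff_left (volume_ball_ne_zero c (by positivity))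
        (volume_ball_ne_top _ _)).1 h3
    have hsub : S ∩ ball c (5 * r) ⊆ {x | t < maximal h x} := by
      rintro y ⟨hy, hyc⟩
      obtain ⟨c', ρ, hyc', hlt⟩ := exists_ball_of_lt_maximal hy.1
      have hρ := pos_of_mem_ball hyc'
      rw [mem_ball] at hyc' hyc
      -- A ball with `ρ ≥ r` has `z` in its 17-fold enlargement (`11 + 5 + 1`), so its average is at
      -- most `17 ^ n * t`, too small. A ball with `ρ ≤ r` lies inside `11B`, where `|g| ≤ h + t`;
      -- there `A ≥ 2` leaves an average of `h` above `t`.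
      rcases le_total r ρ with hrρ | hρr
      · exfalso
        have hzb : z ∈ ball c' (17 * ρ) := by
          rw [mem_ball]
          have := dist_triangle4 z c y c'
          rw [dist_comm c y] at this
          linarith
        have h1 : ∫⁻ y in ball c' ρ, G y ≤ ENNReal.ofReal (17 ^ n) * t * volume (ball c' ρ) := by
          calc _ ≤ ∫⁻ y in ball c' (17 * ρ), G y :=
                lintegral_mono_set (ball_subset_ball (by linarith))
            _ ≤ maximal G z * volume (ball c' (17 * ρ)) := setLIntegral_ball_le_maximal G hzb
            _ ≤ t * volume (ball c' (17 * ρ)) := by gcongr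
            _ = _ := by rw [volume_ball_mul c' c' (by norm_num : (0 : ℝ) < 17)]; ring
        refine absurd (hlt.trans_le h1) (not_lt.2 ?_)
        gcongr
        exact le_self_add
      · have hsubb : ball c' ρ ⊆ ball c (11 * r) := by
          apply ball_subset_ball'
          have := dist_triangle c' y c
          rw [dist_comm c' y] at this
          linarith
        refine lt_maximal_of_ball (mem_ball.2 hyc') ?_
        by_contra hcon
        have hcon := not_lt.1 hcon
        refine absurd hlt (not_lt.2 ?_)
        calc ∫⁻ y in ball c' ρ, G y ≤ ∫⁻ y in ball c' ρ, (h y + ‖a‖ₑ) := by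
              refine setLIntegral_mono' measurableSet_ball fun y hy => ?_
              rw [hh, indicator_of_mem (hsubb hy)]
              calc ‖g y‖ₑ = ‖(g y - a) + a‖ₑ := by rw [sub_add_cancel]
                _ ≤ _ := enorm_add_le _ _
          _ = (∫⁻ y in ball c' ρ, h y) + ‖a‖ₑ * volume (ball c' ρ) := by
              rw [lintegral_add_right _ measurable_const, setLIntegral_const]
          _ ≤ t * volume (ball c' ρ) + t * volume (ball c' ρ) := by gcongr
          _ = (1 + 1) * t * volume (ball c' ρ) := by ring
          _ ≤ A * t * volume (ball c' ρ) := by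
              gcongr
              exact add_le_add h17 le_rfl
    have hweak := mul_volume_lt_maximal_le h ht ht'
    rw [hh, lintegral_indicator measurableSet_ball] at hweak
    have hb : ∫⁻ y in ball c (11 * r), ‖g y - a‖ₑ ≤
        γ * t * (ENNReal.ofReal (11 ^ n) * volume (ball c r)) := by
      refine (setLIntegral_ball_le_sharp g (x := w)
        (ball_subset_ball (by linarith) hwc)).trans ?_
      rw [volume_ball_mul c c (by norm_num : (0 : ℝ) < 11)]
      gcongr
      exact hw.2
    have h5 : t * volume (S ∩ ball c (5 * r)) ≤
        t * (ENNReal.ofReal (5 ^ n) * ENNReal.ofReal (11 ^ n) * γ * volume (ball c r)) := by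
      calc _ ≤ t * volume {x | t < maximal h x} := by gcongr
        _ ≤ _ := hweak
        _ ≤ ENNReal.ofReal (5 ^ n) * (γ * t * (ENNReal.ofReal (11 ^ n) * volume (ball c r))) := by
            gcongr
        _ = _ := by ring
    exact (ENNReal.mul_le_mul_iff_right ht ht').1 h5
  calc volume S ≤ ∑' p : u, volume (S ∩ ball p.1.1 (5 * p.1.2)) :=
        (measure_mono hSsub).trans (measure_biUnion_le volume hcount _)
    _ ≤ ∑' p : u, ENNReal.ofReal (5 ^ n) * ENNReal.ofReal (11 ^ n) * γ *
        volume (ball p.1.1 p.1.2) := ENNReal.tsum_le_tsum fun p => hloc p.1 p.2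
    _ = ENNReal.ofReal (5 ^ n) * ENNReal.ofReal (11 ^ n) * γ *
        volume (⋃ p ∈ u, ball p.1 p.2) := by
        rw [ENNReal.tsum_mul_left, measure_biUnion hcount hdisj fun _ _ => measurableSet_ball]
    _ ≤ _ := by
        gcongr
        exact iUnion₂_subset fun p hp => (hu p hp).2.1

/-- The Fefferman-Stein inequality for functions in `L^p`. -/
theorem exists_lintegral_rpow_le_sharp [NeZero n] {p : ℝ} (hp : 1 < p) :
    ∃ C : ℝ≥0, ∀ g : Rn n → 𝕜, LocallyIntegrable g volume → AEStronglyMeasurable g volume →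
      ∫⁻ x, ‖g x‖ₑ ^ p ≠ ∞ → ∫⁻ x, ‖g x‖ₑ ^ p ≤ C * ∫⁻ x, sharp g x ^ p := by
  have hp0 : 0 < p := by linarith
  obtain ⟨C₁, hC₁⟩ := exists_lintegral_maximal_rpow_le (n := n) hp
  set A : ℝ≥0 := Real.toNNReal (17 ^ n) + 1 with hA
  set D : ℝ≥0 := Real.toNNReal (5 ^ n) * Real.toNNReal (11 ^ n) with hD
  have hD0 : D ≠ 0 := by positivity
  have hA0 : A ≠ 0 := by positivity
  -- Chosen so that `A ^ p * D * γ = 1 / 2`, which lets half of the integral of `(M g) ^ p` be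
  -- absorbed.
  set γ : ℝ≥0 := (2 * A ^ p * D)⁻¹ with hγ
  have hγ0 : γ ≠ 0 := by
    have : (A : ℝ≥0) ^ p ≠ 0 := by positivity
    positivity
  refine ⟨2 * A ^ p * (γ⁻¹) ^ p, fun g hloc hg hfin => ?_⟩
  set G : Rn n → ℝ≥0∞ := fun y => ‖g y‖ₑ with hG
  -- The absorption at the end is legitimate only because this integral is finite; here the
  -- assumption `g ∈ L^p` enters.
  have hMfin : ∫⁻ x, maximal G x ^ p ≠ ∞ :=
    ne_top_of_le_ne_top (ENNReal.mul_ne_top ENNReal.coe_ne_top hfin) (hC₁ G hg.enorm)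
  have hM := measurable_maximal G
  have hset : ∀ t : ℝ, 0 < t → volume {x | ENNReal.ofReal t < maximal G x} ≠ ∞ := by
    intro t ht
    have h1 := mul_meas_ge_le_lintegral₀ (μ := volume) (hM.pow_const p).aemeasurable
      (ENNReal.ofReal t ^ p)
    have h2 : ENNReal.ofReal t ^ p ≠ 0 := by
      simp only [ne_eq, ENNReal.rpow_eq_zero_iff, not_or, not_and_or]
      constructor
      · left; simpa using ht
      · left; simp
    have h3 : volume {x | ENNReal.ofReal t ^ p ≤ maximal G x ^ p} ≠ ∞ := by
      intro h
      rw [h, ENNReal.mul_top h2] at h1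
      exact hMfin (top_le_iff.1 h1)
    refine ne_top_of_le_ne_top h3 (measure_mono fun x hx => ?_)
    exact ENNReal.rpow_le_rpow (le_of_lt hx) hp0.le
  have hAE : ENNReal.ofReal (17 ^ n) + 1 = (A : ℝ≥0∞) := by simp [hA, ENNReal.ofReal]
  have hDE : ENNReal.ofReal (5 ^ n) * ENNReal.ofReal (11 ^ n) = (D : ℝ≥0∞) := by
    simp [hD, ENNReal.ofReal]
  have hAE0 : (A : ℝ≥0∞) ≠ 0 := by simpa using hA0
  have hγE0 : (γ : ℝ≥0∞) ≠ 0 := by simpa using hγ0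
  have hmain : ∫⁻ x, (maximal G x / A) ^ p ≤
      D * γ * (∫⁻ x, maximal G x ^ p) + ∫⁻ x, (sharp g x / γ) ^ p := by
    rw [lintegral_rpow_layercake volume (hM.div_const _) hp0,
      lintegral_rpow_layercake volume hM hp0,
      lintegral_rpow_layercake volume ((measurable_sharp g).div_const _) hp0,
      ← lintegral_const_mul' _ _ (by finiteness), ← lintegral_add_left']
    · refine setLIntegral_mono' measurableSet_Ioi fun t ht => ?_
      have ht : 0 < t := ht
      have ht0 : ENNReal.ofReal t ≠ 0 := by simpa using ht
      have h1 := volume_good_lambda_le (g := g) ht0 ENNReal.ofReal_ne_top (hset t ht) γ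
      rw [hAE, hDE] at h1
      have h2 : {x | ENNReal.ofReal t < maximal G x / A} ⊆
          ({x | A * ENNReal.ofReal t < maximal G x} ∩ {x | sharp g x ≤ γ * ENNReal.ofReal t}) ∪
          {x | ENNReal.ofReal t < sharp g x / γ} := by
        intro x hx
        have hx : ENNReal.ofReal t < maximal G x / A := hx
        rw [ENNReal.lt_div_iff_mul_lt (Or.inl hAE0) (Or.inl ENNReal.coe_ne_top), mul_comm] at hx
        rcases le_or_gt (sharp g x) (γ * ENNReal.ofReal t) with h | h
        · exact Or.inl ⟨hx, h⟩
        · right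
          show ENNReal.ofReal t < sharp g x / γ
          rw [ENNReal.lt_div_iff_mul_lt (Or.inl hγE0) (Or.inl ENNReal.coe_ne_top), mul_comm]
          exact h
      calc _ ≤ ENNReal.ofReal (p * t ^ (p - 1)) *
            (D * γ * volume {x | ENNReal.ofReal t < maximal G x} +
              volume {x | ENNReal.ofReal t < sharp g x / γ}) := by
            gcongr
            exact (measure_mono h2).trans ((measure_union_le _ _).trans (add_le_add h1 le_rfl))
        _ = _ := by ring
    · refine (Measurable.mul (by fun_prop) (Measurable.mul (by fun_prop) ?_)).aemeasurable
      exact Antitone.measurable fun s t hst => measure_mono fun x hx =>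
        lt_of_le_of_lt (ENNReal.ofReal_le_ofReal hst) hx
  have hAp : (A : ℝ≥0∞) ^ p ≠ 0 := by
    simp [ENNReal.rpow_eq_zero_iff, hp0, not_lt.2 hp0.le, hA0]
  have hAp' : (A : ℝ≥0∞) ^ p ≠ ∞ := ENNReal.rpow_ne_top_of_nonneg hp0.le ENNReal.coe_ne_top
  have e1 : ∫⁻ x, maximal G x ^ p = A ^ p * ∫⁻ x, (maximal G x / A) ^ p := by
    rw [← lintegral_const_mul' _ _ hAp']
    refine lintegral_congr fun x => ?_
    rw [← ENNReal.mul_rpow_of_nonneg _ _ hp0.le, ENNReal.mul_div_cancel hAE0 ENNReal.coe_ne_top]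
  have e2 : ∫⁻ x, (sharp g x / γ) ^ p = (γ⁻¹ : ℝ≥0) ^ p * ∫⁻ x, sharp g x ^ p := by
    rw [← lintegral_const_mul' _ _ (ENNReal.rpow_ne_top_of_nonneg hp0.le ENNReal.coe_ne_top)]
    refine lintegral_congr fun x => ?_
    rw [← ENNReal.mul_rpow_of_nonneg _ _ hp0.le, ENNReal.coe_inv hγ0, mul_comm, div_eq_mul_inv]
  have e3 : (A : ℝ≥0∞) ^ p * (D * γ) = 2⁻¹ := by
    rw [← ENNReal.coe_rpow_of_nonneg _ hp0.le]
    have : A ^ p * (D * γ) = 2⁻¹ := by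
      have : A ^ p ≠ 0 := by positivity
      rw [hγ]; field_simp
    rw [← ENNReal.coe_mul, ← ENNReal.coe_mul, this]
    simp
  have hle : ∫⁻ x, maximal G x ^ p ≤ 2⁻¹ * (∫⁻ x, maximal G x ^ p) +
      A ^ p * ((γ⁻¹ : ℝ≥0) ^ p * ∫⁻ x, sharp g x ^ p) := by
    calc _ = A ^ p * ∫⁻ x, (maximal G x / A) ^ p := e1
      _ ≤ A ^ p * (D * γ * (∫⁻ x, maximal G x ^ p) + ∫⁻ x, (sharp g x / γ) ^ p) := by gcongr
      _ = _ := by rw [mul_add, ← mul_assoc, e3, e2]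
  have hfin2 : ∫⁻ x, maximal G x ^ p ≤ 2 * (A ^ p * ((γ⁻¹ : ℝ≥0) ^ p * ∫⁻ x, sharp g x ^ p)) := by
    set X := ∫⁻ x, maximal G x ^ p
    have hX : (2 : ℝ≥0∞)⁻¹ * X ≠ ∞ := ENNReal.mul_ne_top (by simp) hMfin
    have h1 : X = 2⁻¹ * X + 2⁻¹ * X := by
      rw [← add_mul, ENNReal.inv_two_add_inv_two, one_mul]
    have h2 : 2⁻¹ * X + 2⁻¹ * X ≤
        2⁻¹ * X + A ^ p * ((γ⁻¹ : ℝ≥0) ^ p * ∫⁻ x, sharp g x ^ p) := h1 ▸ hle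
    have h3 := (ENNReal.add_le_add_iff_left hX).1 h2
    calc X = 2 * (2⁻¹ * X) := by
          rw [← mul_assoc, ENNReal.mul_inv_cancel (by simp) (by simp), one_mul]
      _ ≤ _ := by gcongr
  calc ∫⁻ x, ‖g x‖ₑ ^ p ≤ ∫⁻ x, maximal G x ^ p := by
        refine lintegral_mono_ae ?_
        filter_upwards [enorm_ae_le_maximal hloc] with x hx
        gcongr
    _ ≤ _ := hfin2
    _ = _ := by
        push_cast
        rw [ENNReal.coe_rpow_of_nonneg _ hp0.le, ENNReal.coe_rpow_of_nonneg _ hp0.le]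
        ring

end Sharp

/-! ### BMO and the John-Nirenberg inequality -/

section JohnNirenberg

variable {n : ℕ} {𝕜 : Type*} [RCLike 𝕜]

/-- All mean oscillations of `b` over balls are at most `β`. -/
structure MeanOscLE (b : Rn n → 𝕜) (β : ℝ≥0∞) : Prop where
  loc : LocallyIntegrable b volume
  osc : ∀ (c : Rn n) (r : ℝ), 0 < r →
    ∫⁻ y in ball c r, ‖b y - ⨍ z in ball c r, b z‖ₑ ≤ β * volume (ball c r)

theorem integrableOn_ball {b : Rn n → 𝕜} (hb : LocallyIntegrable b volume) (c : Rn n) (r : ℝ) :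
    IntegrableOn b (ball c r) volume :=
  (hb.integrableOn_isCompact (isCompact_closedBall c r)).mono_set ball_subset_closedBall

/-- The norm is an essential supremum, but every ball has positive measure and so contains a point
where the sharp function obeys the bound. Hence the oscillation bound holds on every ball without
exception. -/
theorem IsBMO.meanOscLE {b : Rn n → 𝕜} (hb : IsBMO b) {β : ℝ≥0∞} (hβ : bmoNorm b ≤ β) :
    MeanOscLE b β := by
  refine ⟨hb.1, fun c r hr => ?_⟩
  have h1 : ∀ᵐ x, sharp b x ≤ bmoNorm b := ENNReal.ae_le_essSup _
  obtain ⟨x, hx, hxs⟩ : ∃ x ∈ ball c r, sharp b x ≤ bmoNorm b := by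
    by_contra! h
    refine volume_ball_ne_zero c hr (measure_mono_null (fun x hx => ?_) h1)
    exact not_le.2 (h x hx)
  refine (setLIntegral_ball_le_sharp b hx).trans ?_
  gcongr
  exact hxs.trans hβ

theorem bmoNorm_le_of_meanOscLE {b : Rn n → 𝕜} {β : ℝ≥0∞} (hb : MeanOscLE b β) :
    bmoNorm b ≤ β :=
  essSup_le_of_ae_le _ (ae_of_all _ fun _ => sharp_le_of_forall_ball fun c r hx =>
    hb.osc c r (pos_of_mem_ball hx))

theorem MeanOscLE.enorm_average_sub_le {b : Rn n → 𝕜} {β : ℝ≥0∞} (hb : MeanOscLE b β)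
    {c c' : Rn n} {r : ℝ} (hr : 0 < r) {a : ℝ} (ha : 0 < a)
    (hsub : ball c r ⊆ ball c' (a * r)) :
    ‖(⨍ z in ball c r, b z) - ⨍ z in ball c' (a * r), b z‖ₑ ≤ ENNReal.ofReal (a ^ n) * β := by
  have h1 := enorm_setAverage_sub_mul_le hr (integrableOn_ball hb.loc c r)
    (⨍ z in ball c' (a * r), b z)
  have h2 := (h1.trans (lintegral_mono_set hsub)).trans (hb.osc c' (a * r) (by positivity))
  rw [volume_ball_mul c' c ha, ← mul_assoc, mul_comm β] at h2
  exact (ENNReal.mul_le_mul_iff_left (volume_ball_ne_zero c hr) (volume_ball_ne_top c r)).1 h2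

theorem MeanOscLE.lintegral_double_le {b : Rn n → 𝕜} {β : ℝ≥0∞} (hb : MeanOscLE b β)
    (c : Rn n) {r : ℝ} (hr : 0 < r) :
    ∫⁻ y in ball c (2 * r), ‖b y - ⨍ z in ball c r, b z‖ₑ ≤
      ENNReal.ofReal (2 * 4 ^ n) * β * volume (ball c r) := by
  set a := ⨍ z in ball c r, b z
  set a' := ⨍ z in ball c (2 * r), b z
  have h1 : ‖a - a'‖ₑ ≤ ENNReal.ofReal (2 ^ n) * β :=
    hb.enorm_average_sub_le hr two_pos (ball_subset_ball (by linarith))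
  calc _ ≤ ∫⁻ y in ball c (2 * r), (‖b y - a'‖ₑ + ‖a - a'‖ₑ) := by
        refine lintegral_mono fun y => ?_
        have : b y - a = (b y - a') - (a - a') := by ring
        rw [this]
        exact enorm_sub_le
    _ = (∫⁻ y in ball c (2 * r), ‖b y - a'‖ₑ) + ‖a - a'‖ₑ * volume (ball c (2 * r)) := by
        rw [lintegral_add_right _ measurable_const, setLIntegral_const]
    _ ≤ β * volume (ball c (2 * r)) + ENNReal.ofReal (2 ^ n) * β * volume (ball c (2 * r)) := by
        gcongr
        exact hb.osc c _ (by positivity)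
    _ = (1 + ENNReal.ofReal (2 ^ n)) * ENNReal.ofReal (2 ^ n) * β * volume (ball c r) := by
        rw [volume_ball_mul c c two_pos]; ring
    _ ≤ _ := by
        gcongr
        rw [← ENNReal.ofReal_one, ← ENNReal.ofReal_add (by positivity) (by positivity),
          ← ENNReal.ofReal_mul (by positivity)]
        apply ENNReal.ofReal_le_ofReal
        have h4 : (4 : ℝ) ^ n = 2 ^ n * 2 ^ n := by rw [← mul_pow]; norm_num
        have : (1 : ℝ) ≤ 2 ^ n := one_le_pow₀ (by norm_num)
        rw [h4]
        nlinarith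

/-- Exponential decay by induction on `k`, for all balls at once. Where `|b - a|` is large, up to a
null set, lies in an open set `E` covered by Whitney balls. On each enlarged ball the average of `b`
has moved by at most `A * β`, so the induction hypothesis applies there one level lower, and `E` is
small enough to gain a factor `1 / 2`. -/
theorem exists_volume_oscillation_le [NeZero n] : ∃ A : ℝ≥0, A ≠ 0 ∧
    ∀ (b : Rn n → 𝕜) (β : ℝ≥0∞), β ≠ 0 → β ≠ ∞ → MeanOscLE b β →
    ∀ (k : ℕ) (c : Rn n) (r : ℝ), 0 < r →
      volume (ball c r ∩ {x | k * (A * β) < ‖b x - ⨍ z in ball c r, b z‖ₑ}) ≤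
        2⁻¹ ^ k * volume (ball c r) := by
  -- The first two factors come from the weak type bound and from `lintegral_double_le`. The bracket
  -- makes `E` small: `16 ^ n` keeps the Whitney balls small compared with `r`, `5 ^ n` pays for
  -- enlarging them, and 2 gives the halving.
  set A₁ : ℝ≥0 := Real.toNNReal (5 ^ n) * Real.toNNReal (2 * 4 ^ n) *
    (2 * Real.toNNReal (16 ^ n) * Real.toNNReal (5 ^ n)) with hA₁
  have hA₁0 : A₁ ≠ 0 := by positivity
  refine ⟨Real.toNNReal (11 ^ n) * A₁, by positivity, fun b β hβ0 hβ hb k => ?_⟩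
  set A := Real.toNNReal (11 ^ n) * A₁ with hA
  have h11 : (1 : ℝ≥0) ≤ Real.toNNReal (11 ^ n) := by
    rw [Real.one_le_toNNReal]; exact one_le_pow₀ (by norm_num)
  induction k with
  | zero => intro c r _; simpa using measure_mono inter_subset_left
  | succ k ih =>
    intro c r hr
    set a := ⨍ z in ball c r, b z with ha
    -- The doubled ball leaves room for the enlarged Whitney balls that meet `ball c r`.
    set g : Rn n → 𝕜 := (ball c (2 * r)).indicator fun y => b y - a with hg
    have hgint : Integrable g volume := by
      rw [hg, integrable_indicator_iff measurableSet_ball]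
      exact (integrableOn_ball hb.loc _ _).sub (integrableOn_const (volume_ball_ne_top _ _))
    set F : Rn n → ℝ≥0∞ := fun y => ‖g y‖ₑ with hF
    have hFint : ∫⁻ y, F y ≤ ENNReal.ofReal (2 * 4 ^ n) * β * volume (ball c r) := by
      have : F = (ball c (2 * r)).indicator fun y => ‖b y - a‖ₑ := by
        ext y; simp only [hF, hg, enorm_indicator_eq_indicator_enorm]
      rw [this, lintegral_indicator measurableSet_ball]
      exact hb.lintegral_double_le c hr
    set t : ℝ≥0∞ := A₁ * β with ht
    have ht0 : t ≠ 0 := by simp [ht, hβ0, hA₁0]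
    have htt : t ≠ ∞ := ENNReal.mul_ne_top ENNReal.coe_ne_top hβ
    set E := {x | t < maximal F x} with hE
    have hEvol : ENNReal.ofReal (2 * 16 ^ n * 5 ^ n) * volume E ≤ volume (ball c r) := by
      have h1 := (mul_volume_lt_maximal_le F ht0 htt).trans (mul_le_mul_right hFint _)
      have h2 : t = ENNReal.ofReal (5 ^ n) * (ENNReal.ofReal (2 * 4 ^ n) * β) *
          ENNReal.ofReal (2 * 16 ^ n * 5 ^ n) := by
        rw [ht, hA₁, ENNReal.ofReal_mul (p := 2 * 16 ^ n) (by positivity),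
          ENNReal.ofReal_mul (p := 2) (q := 16 ^ n) (by positivity)]
        simp only [ENNReal.ofReal, ENNReal.coe_mul, ENNReal.coe_ofNat]
        rw [Real.toNNReal_ofNat]
        push_cast
        ring
      have h3 : ENNReal.ofReal (5 ^ n) * (ENNReal.ofReal (2 * 4 ^ n) * β) *
          (ENNReal.ofReal (2 * 16 ^ n * 5 ^ n) * volume E) ≤
          ENNReal.ofReal (5 ^ n) * (ENNReal.ofReal (2 * 4 ^ n) * β) * volume (ball c r) := by
        rw [← mul_assoc, ← h2, mul_assoc (ENNReal.ofReal (5 ^ n))]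
        exact h1
      refine (ENNReal.mul_le_mul_iff_right ?_ (by finiteness)).1 h3
      have e1 : ENNReal.ofReal (5 ^ n) ≠ 0 := by simp
      have e2 : ENNReal.ofReal (2 * 4 ^ n) ≠ 0 := by simp
      exact mul_ne_zero e1 (mul_ne_zero e2 hβ0)
    have hEfin : volume E ≠ ∞ := by
      intro h
      rw [h, ENNReal.mul_top (by simp)] at hEvol
      exact volume_ball_ne_top c r (top_le_iff.1 hEvol)
    obtain ⟨u, hcount, hu, hdisj, hcov⟩ := exists_whitney_cover (isOpen_lt_maximal F t) hEfin
    set N := {x | ¬ ‖g x‖ₑ ≤ maximal F x} with hN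
    have hN0 : volume N = 0 := enorm_ae_le_maximal hgint.locallyIntegrable
    have hsmall : ∀ p ∈ u, 16 * p.2 < r := by
      rintro p hp
      by_contra! hcon
      obtain ⟨hp0, hpE, -⟩ := hu p hp
      have h1 : volume (ball c r) ≤ ENNReal.ofReal (16 ^ n) * volume E := by
        calc volume (ball c r) = volume (ball p.1 r) := by
              simpa using volume_ball_mul c p.1 one_pos r
          _ ≤ volume (ball p.1 (16 * p.2)) := measure_mono (ball_subset_ball hcon)
          _ = ENNReal.ofReal (16 ^ n) * volume (ball p.1 p.2) :=
              volume_ball_mul _ _ (by norm_num) _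
          _ ≤ _ := by gcongr
      have hE0 : volume E ≠ 0 := fun h => by
        rw [h, mul_zero] at h1
        exact volume_ball_ne_zero c hr (le_zero_iff.1 h1)
      have h2 := (ENNReal.mul_le_mul_iff_left hE0 hEfin).1 (hEvol.trans h1)
      rw [ENNReal.ofReal_le_ofReal_iff (by positivity)] at h2
      have h5 : (1 : ℝ) ≤ 5 ^ n := one_le_pow₀ (by norm_num)
      have h16 : (0 : ℝ) < 16 ^ n := by positivity
      nlinarith
    have hsub : ball c r ∩ {x | (k + 1 : ℕ) * (A * β) < ‖b x - a‖ₑ} ⊆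
        N ∪ ⋃ p ∈ u, (ball p.1 (5 * p.2) ∩
          {x | k * (A * β) < ‖b x - ⨍ z in ball p.1 (5 * p.2), b z‖ₑ}) := by
      rintro x ⟨hxB, hx⟩
      have hx : (k + 1 : ℕ) * (A * β) < ‖b x - a‖ₑ := hx
      by_cases hxN : x ∈ N
      · exact Or.inl hxN
      right
      have hxN : ‖g x‖ₑ ≤ maximal F x := not_not.1 hxN
      have hgx : g x = b x - a := indicator_of_mem (ball_subset_ball (by linarith) hxB) _
      have hxE : x ∈ E := by
        refine lt_of_le_of_lt ?_ (hx.trans_le (hgx ▸ hxN))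
        calc t = 1 * (1 * t) := by ring
          _ ≤ (k + 1 : ℕ) * (Real.toNNReal (11 ^ n) * t) := by
              gcongr
              · exact_mod_cast Nat.le_add_left 1 k
              · exact_mod_cast h11
          _ = _ := by rw [hA]; push_cast; ring
      obtain ⟨p, hp, hxp⟩ := mem_iUnion₂.1 (hcov hxE)
      obtain ⟨hp0, -, z, hz, hzp⟩ := hu p hp
      have hz : maximal F z ≤ t := not_lt.1 hz
      refine mem_biUnion hp ⟨hxp, ?_⟩
      set a' := ⨍ z in ball p.1 (5 * p.2), b z with ha'
      show k * (A * β) < ‖b x - a'‖ₑ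
      -- The 11-fold ball contains `z`, where the maximal function is at most `t`, and it lies in
      -- `ball c (2 * r)`, since its centre is within `r + 5 * p.2` of `c` and `16 * p.2 < r`.
      have haa : ‖a' - a‖ₑ ≤ A * β := by
        have h1 := enorm_setAverage_sub_mul_le (c := p.1) (r := 5 * p.2) (by positivity)
          (integrableOn_ball hb.loc _ _) a
        have h2 : ball p.1 (11 * p.2) ⊆ ball c (2 * r) := by
          apply ball_subset_ball'
          rw [mem_ball] at hxp hxB
          have := dist_triangle p.1 x c
          rw [dist_comm p.1 x] at this
          linarith [hsmall p hp]
        have h3 : ∫⁻ y in ball p.1 (5 * p.2), ‖b y - a‖ₑ ≤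
            A * β * volume (ball p.1 (5 * p.2)) := by
          calc _ ≤ ∫⁻ y in ball p.1 (11 * p.2), ‖b y - a‖ₑ :=
                lintegral_mono_set (ball_subset_ball (by linarith))
            _ = ∫⁻ y in ball p.1 (11 * p.2), F y := by
                refine setLIntegral_congr_fun measurableSet_ball fun y hy => ?_
                simp only [hF, hg, indicator_of_mem (h2 hy)]
            _ ≤ maximal F z * volume (ball p.1 (11 * p.2)) :=
                setLIntegral_ball_le_maximal F (mem_ball.2 hzp)
            _ ≤ t * (ENNReal.ofReal (11 ^ n) * volume (ball p.1 (5 * p.2))) := by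
                rw [volume_ball_mul p.1 p.1 (by norm_num : (0 : ℝ) < 11)]
                gcongr
                linarith
            _ = _ := by rw [hA]; push_cast; simp only [ENNReal.ofReal]; rw [ht]; ring
        exact (ENNReal.mul_le_mul_iff_left (volume_ball_ne_zero _ (by positivity))
          (volume_ball_ne_top _ _)).1 (h1.trans h3)
      by_contra! hcon
      refine absurd hx (not_lt.2 ?_)
      calc ‖b x - a‖ₑ = ‖(b x - a') + (a' - a)‖ₑ := by rw [sub_add_sub_cancel]
        _ ≤ ‖b x - a'‖ₑ + ‖a' - a‖ₑ := enorm_add_le _ _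
        _ ≤ k * (A * β) + A * β := add_le_add hcon haa
        _ = _ := by push_cast; ring
    calc _ ≤ volume N + ∑' p : u, volume (ball p.1.1 (5 * p.1.2) ∩
          {x | k * (A * β) < ‖b x - ⨍ z in ball p.1.1 (5 * p.1.2), b z‖ₑ}) :=
          (measure_mono hsub).trans ((measure_union_le _ _).trans
            (add_le_add le_rfl (measure_biUnion_le volume hcount _)))
      _ ≤ 0 + ∑' p : u, 2⁻¹ ^ k * ENNReal.ofReal (5 ^ n) * volume (ball p.1.1 p.1.2) := by
          rw [hN0]
          gcongr with p
          refine (ih p.1.1 (5 * p.1.2) (by have := (hu p.1 p.2).1; positivity)).trans ?_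
          rw [volume_ball_mul p.1.1 p.1.1 (by norm_num : (0 : ℝ) < 5), mul_assoc]
      _ = 2⁻¹ ^ k * ENNReal.ofReal (5 ^ n) * volume (⋃ p ∈ u, ball p.1 p.2) := by
          rw [zero_add, ENNReal.tsum_mul_left,
            measure_biUnion hcount hdisj fun _ _ => measurableSet_ball]
      _ ≤ 2⁻¹ ^ k * ENNReal.ofReal (5 ^ n) * volume E := by
          gcongr
          exact iUnion₂_subset fun p hp => (hu p hp).2.1
      _ ≤ 2⁻¹ ^ k * (2⁻¹ * volume (ball c r)) := by
          rw [mul_assoc]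
          refine mul_le_mul_right ?_ _
          have h1 : (2 : ℝ≥0∞) * (ENNReal.ofReal (5 ^ n) * volume E) ≤ volume (ball c r) := by
            refine le_trans ?_ hEvol
            rw [← mul_assoc]
            gcongr
            rw [← ENNReal.ofReal_ofNat 2, ← ENNReal.ofReal_mul (by positivity)]
            apply ENNReal.ofReal_le_ofReal
            have h16 : (1 : ℝ) ≤ 16 ^ n := one_le_pow₀ (by norm_num)
            have h5 : (0 : ℝ) < 5 ^ n := by positivity
            nlinarith
          rwa [← ENNReal.inv_mul_le_iff (by simp) (by simp), inv_inv]
      _ = _ := by rw [pow_succ, mul_assoc]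

theorem lintegral_rpow_layercake₀ {X : Type*} [MeasurableSpace X] (μ : Measure X) [SFinite μ]
    {F : X → ℝ≥0∞} (hF : AEMeasurable F μ) {q : ℝ} (hq : 0 < q) :
    ∫⁻ x, F x ^ q ∂μ = ∫⁻ t in Ioi (0 : ℝ), ENNReal.ofReal (q * t ^ (q - 1)) *
      μ {x | ENNReal.ofReal t < F x} := by
  obtain ⟨G, hG, hFG⟩ := hF
  rw [lintegral_congr_ae (hFG.mono fun x hx => show F x ^ q = G x ^ q by rw [hx]),
    lintegral_rpow_layercake μ hG hq]
  refine lintegral_congr fun t => ?_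
  congr 1
  exact measure_congr (hFG.mono fun x hx => by
    show (ENNReal.ofReal t < G x) = (ENNReal.ofReal t < F x)
    rw [hx])

/-- The John-Nirenberg inequality in `L^q` form. -/
theorem exists_lintegral_oscillation_rpow_le [NeZero n] {q : ℝ} (hq : 0 < q) : ∃ C : ℝ≥0,
    ∀ (b : Rn n → 𝕜) (β : ℝ≥0∞), β ≠ 0 → β ≠ ∞ → MeanOscLE b β →
    ∀ (c : Rn n) (r : ℝ), 0 < r →
      ∫⁻ x in ball c r, ‖b x - ⨍ z in ball c r, b z‖ₑ ^ q ≤ C * β ^ q * volume (ball c r) := by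
  obtain ⟨A, hA0, hA⟩ := exists_volume_oscillation_le (n := n) (𝕜 := 𝕜)
  have hI : ∫⁻ t in Ioi (0 : ℝ), ENNReal.ofReal (q * t ^ (q - 1)) *
      ENNReal.ofReal (2 * Real.exp (-Real.log 2 * t ^ (1 : ℝ))) ≠ ∞ := by
    have h1 := integrableOn_rpow_mul_exp_neg_mul_rpow (p := 1) (s := q - 1) (b := Real.log 2)
      (by linarith) one_pos (Real.log_pos (by norm_num))
    have h2 := (h1.const_mul (q * 2)).lintegral_lt_top
    refine ne_of_lt (lt_of_le_of_lt (le_of_eq ?_) h2)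
    refine setLIntegral_congr_fun measurableSet_Ioi fun t ht => ?_
    have ht : 0 < t := ht
    rw [← ENNReal.ofReal_mul (by positivity)]
    congr 1
    ring
  set I := ∫⁻ t in Ioi (0 : ℝ), ENNReal.ofReal (q * t ^ (q - 1)) *
      ENNReal.ofReal (2 * Real.exp (-Real.log 2 * t ^ (1 : ℝ))) with hIdef
  refine ⟨I.toNNReal * A ^ q, fun b β hβ0 hβ hb c r hr => ?_⟩
  set a := ⨍ z in ball c r, b z
  have hAβ0 : (A : ℝ≥0∞) * β ≠ 0 := mul_ne_zero (by simpa using hA0) hβ0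
  have hAβ : (A : ℝ≥0∞) * β ≠ ∞ := ENNReal.mul_ne_top ENNReal.coe_ne_top hβ
  have hmeas : AEMeasurable (fun x => ‖b x - a‖ₑ / (A * β)) (volume.restrict (ball c r)) :=
    ((hb.loc.aestronglyMeasurable.sub aestronglyMeasurable_const).enorm.restrict).div_const _
  have h1 : ∫⁻ x in ball c r, (‖b x - a‖ₑ / (A * β)) ^ q ≤ I * volume (ball c r) := by
    rw [lintegral_rpow_layercake₀ _ hmeas hq, hIdef,
      ← lintegral_mul_const' _ _ (volume_ball_ne_top c r)]
    refine setLIntegral_mono' measurableSet_Ioi fun t ht => ?_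
    have ht : 0 < t := ht
    rw [mul_assoc]
    refine mul_le_mul_right ?_ _
    rw [Measure.restrict_apply' measurableSet_ball]
    -- Rounding `t` down to an integer level costs a factor 2, since `2 ^ (-⌊t⌋) ≤ 2 * 2 ^ (-t)`;
    -- this is the 2 inside `I`.
    have h2 := hA b β hβ0 hβ hb ⌊t⌋₊ c r hr
    refine (measure_mono ?_).trans (h2.trans (mul_le_mul_left ?_ _))
    · rintro x ⟨hx, hxB⟩
      refine ⟨hxB, ?_⟩
      have hx : ENNReal.ofReal t < ‖b x - a‖ₑ / (A * β) := hx
      rw [ENNReal.lt_div_iff_mul_lt (Or.inl hAβ0) (Or.inl hAβ)] at hx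
      refine lt_of_le_of_lt ?_ hx
      gcongr
      rw [← ENNReal.ofReal_natCast]
      exact ENNReal.ofReal_le_ofReal (Nat.floor_le ht.le)
    · have h3 : (2 : ℝ≥0∞)⁻¹ ^ ⌊t⌋₊ = ENNReal.ofReal (2⁻¹ ^ ⌊t⌋₊) := by
        rw [ENNReal.ofReal_pow (by norm_num), ENNReal.ofReal_inv_of_pos (by norm_num),
          ENNReal.ofReal_ofNat]
      rw [h3]
      apply ENNReal.ofReal_le_ofReal
      rw [Real.rpow_one, neg_mul, Real.exp_neg, ← Real.rpow_def_of_pos (by norm_num), inv_pow,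
        ← Real.rpow_natCast, ← div_eq_mul_inv, inv_le_comm₀ (by positivity) (by positivity),
        inv_div, div_le_iff₀ (by norm_num)]
      calc (2 : ℝ) ^ t ≤ 2 ^ ((⌊t⌋₊ : ℝ) + 1) :=
            Real.rpow_le_rpow_of_exponent_le (by norm_num) (Nat.lt_floor_add_one t).le
        _ = _ := by rw [Real.rpow_add_one (by norm_num)]
  calc _ = (A * β) ^ q * ∫⁻ x in ball c r, (‖b x - a‖ₑ / (A * β)) ^ q := by
        rw [← lintegral_const_mul' _ _ (ENNReal.rpow_ne_top_of_nonneg hq.le hAβ)]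
        refine lintegral_congr fun x => ?_
        rw [← ENNReal.mul_rpow_of_nonneg _ _ hq.le, ENNReal.mul_div_cancel hAβ0 hAβ]
    _ ≤ (A * β) ^ q * (I * volume (ball c r)) := by gcongr
    _ = _ := by
        rw [ENNReal.coe_mul, ENNReal.coe_toNNReal hI, ENNReal.mul_rpow_of_nonneg _ _ hq.le,
          ENNReal.coe_rpow_of_nonneg _ hq.le]
        ring

end JohnNirenberg

/-! ### Operators on `L^p` and their kernel -/

section Operator

variable {n : ℕ} {𝕜 : Type*} [RCLike 𝕜] {T : (Rn n → 𝕜) → (Rn n → 𝕜)}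

theorem one_lt_of_mem_expRange {m : ℝ} (hm : 1 < m) {p : ℝ≥0∞} (hp : p ∈ expRange m) : 1 < p := by
  refine lt_of_le_of_lt ?_ hp.1
  rw [ENNReal.one_le_ofReal, le_div_iff₀ (by linarith)]
  linarith

theorem IsLpBoundedBy.sub {p C : ℝ≥0∞} (hT : IsLpBoundedBy T p C) {f g : Rn n → 𝕜}
    (hf : MemLp f p volume) (hg : MemLp g p volume) : T (f - g) =ᵐ[volume] T f - T g := by
  have h1 := hT.add f ((-1 : 𝕜) • g) hf (hg.const_smul _)
  have h2 := hT.smul (-1) g hg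
  have h3 : f - g = f + (-1 : 𝕜) • g := by ext y; simp [sub_eq_add_neg]
  rw [h3]
  filter_upwards [h1, h2] with x h1 h2
  rw [h1, Pi.add_apply, h2]
  simp [sub_eq_add_neg]

theorem IsLpBoundedBy.congr_ae {p C : ℝ≥0∞} (hT : IsLpBoundedBy T p C) (hp : p ≠ 0)
    {f g : Rn n → 𝕜} (hf : MemLp f p volume) (hfg : f =ᵐ[volume] g) : T f =ᵐ[volume] T g := by
  have hg : MemLp g p volume := hf.ae_eq hfg
  have h0 : eLpNorm (T (f - g)) p volume = 0 := by
    have h1 := hT.bound (f - g) (hf.sub hg)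
    have h2 : eLpNorm (f - g) p volume = 0 := by
      rw [eLpNorm_congr_ae (g := 0) (hfg.mono fun x hx => by simp [hx]), eLpNorm_zero]
    rwa [h2, mul_zero, le_zero_iff] at h1
  rw [eLpNorm_eq_zero_iff (hT.memLp _ (hf.sub hg)).1 hp] at h0
  filter_upwards [h0, hT.sub hf hg] with x hx1 hx2
  rw [hx1, Pi.sub_apply] at hx2
  exact (sub_eq_zero.1 hx2.symm)

theorem eLpNorm_rpow_toReal {p : ℝ≥0∞} (hp0 : p ≠ 0) (hp : p ≠ ∞) (f : Rn n → 𝕜) :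
    eLpNorm f p volume ^ p.toReal = ∫⁻ x, ‖f x‖ₑ ^ p.toReal := by
  have := ENNReal.toReal_pos hp0 hp
  rw [eLpNorm_eq_lintegral_rpow_enorm_toReal hp0 hp, ← ENNReal.rpow_mul, one_div_mul_cancel this.ne',
    ENNReal.rpow_one]

/-- Dominated convergence in `L^p`. -/
theorem tendsto_eLpNorm_sub_of_le {p : ℝ≥0∞} (hp0 : p ≠ 0) (hp : p ≠ ∞) {u : Rn n → 𝕜}
    (hu : MemLp u p volume) {w : ℕ → Rn n → 𝕜} (hw : ∀ j, AEStronglyMeasurable (w j) volume)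
    (hle : ∀ j x, ‖w j x‖ ≤ ‖u x‖) (hlim : ∀ x, Tendsto (fun j => w j x) atTop (𝓝 (u x))) :
    Tendsto (fun j => eLpNorm (w j - u) p volume) atTop (𝓝 0) := by
  have hq := ENNReal.toReal_pos hp0 hp
  have h1 : Tendsto (fun j => ∫⁻ x, ‖(w j - u) x‖ₑ ^ p.toReal) atTop (𝓝 (∫⁻ _x : Rn n, 0)) := by
    refine tendsto_lintegral_of_dominated_convergence' (fun x => (2 * ‖u x‖ₑ) ^ p.toReal)
      (fun j => ((hw j).sub hu.1).enorm.pow_const _) (fun j => ae_of_all _ fun x => ?_) ?_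
      (ae_of_all _ fun x => ?_)
    · dsimp only
      gcongr
      calc ‖w j x - u x‖ₑ ≤ ‖w j x‖ₑ + ‖u x‖ₑ := enorm_sub_le
        _ ≤ ‖u x‖ₑ + ‖u x‖ₑ := by
            gcongr
            exact enorm_le_iff_norm_le.2 (hle j x)
        _ = _ := (two_mul _).symm
    · simp_rw [ENNReal.mul_rpow_of_nonneg _ _ hq.le]
      rw [lintegral_const_mul' _ _ (by finiteness), ← eLpNorm_rpow_toReal hp0 hp]
      exact ENNReal.mul_ne_top (by finiteness) (ENNReal.rpow_ne_top_of_nonneg hq.le hu.2.ne)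
    · have h2 : Tendsto (fun j => w j x - u x) atTop (𝓝 0) := by
        simpa using (hlim x).sub_const (u x)
      have h3 := (h2.enorm).ennrpow_const p.toReal
      simpa [hq] using h3
  simp_rw [← eLpNorm_rpow_toReal hp0 hp] at h1
  have h2 := h1.ennrpow_const (1 / p.toReal)
  simpa [← ENNReal.rpow_mul, hq.ne', hq] using h2

theorem IsLpBoundedBy.tendstoInMeasure {p C : ℝ≥0∞} (hC : C ≠ ∞) (hT : IsLpBoundedBy T p C)
    (hp0 : p ≠ 0) {u : Rn n → 𝕜} {w : ℕ → Rn n → 𝕜}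
    (hu : MemLp u p volume) (hw : ∀ j, MemLp (w j) p volume)
    (h : Tendsto (fun j => eLpNorm (w j - u) p volume) atTop (𝓝 0)) :
    TendstoInMeasure volume (fun j => T (w j)) atTop (T u) := by
  refine tendstoInMeasure_of_tendsto_eLpNorm hp0 (fun j => (hT.memLp _ (hw j)).1)
    (hT.memLp _ hu).1 ?_
  have h1 := ENNReal.Tendsto.const_mul h (Or.inr hC)
  rw [mul_zero] at h1
  refine tendsto_of_tendsto_of_tendsto_of_le_of_le tendsto_const_nhds h1 (fun _ => zero_le)
    fun j => ?_
  rw [eLpNorm_congr_ae (hT.sub (hw j) hu).symm]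
  exact hT.bound _ ((hw j).sub hu)

theorem exists_common_seq_tendsto_ae {X E F : Type*} [MeasurableSpace X] {μ : Measure X}
    [NormedAddCommGroup E] [NormedAddCommGroup F]
    {f : ℕ → X → E} {f' : X → E} {g : ℕ → X → F} {g' : X → F}
    (hf : TendstoInMeasure μ f atTop f') (hg : TendstoInMeasure μ g atTop g') :
    ∃ ns : ℕ → ℕ, StrictMono ns ∧ (∀ᵐ x ∂μ, Tendsto (fun j => f (ns j) x) atTop (𝓝 (f' x))) ∧
      ∀ᵐ x ∂μ, Tendsto (fun j => g (ns j) x) atTop (𝓝 (g' x)) := by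
  obtain ⟨ns, hns, h1⟩ := hf.exists_seq_tendsto_ae
  obtain ⟨ms, hms, h2⟩ := (hg.comp hns.tendsto_atTop).exists_seq_tendsto_ae
  refine ⟨ns ∘ ms, hns.comp hms, ?_, h2⟩
  filter_upwards [h1] with x hx using hx.comp hms.tendsto_atTop

theorem IsBddCompact.memLp {f : Rn n → 𝕜} (hf : IsBddCompact f) (p : ℝ≥0∞) :
    MemLp f p volume := by
  exact hf.1.mono_exponent_of_measure_support_ne_top
    (fun x hx => image_eq_zero_of_notMem_tsupport hx) hf.2.isCompact.measure_ne_top le_top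

/-- The kernel represents `T` only on bounded functions of compact support, and `u - v` need not lie
in any single `L^p`. Common truncations of `u` and `v` are representable, and their images converge
a.e. along a common subsequence. Only the difference of kernels at two points is dominated
uniformly; the separate integrals against `K z` need not converge. -/
theorem exists_ae_kernel_bound {m : ℝ} (hm : 1 < m) {K : Rn n → Rn n → 𝕜}
    (hT : ∀ p ∈ expRange m, IsLpBounded T p) (hTK : HasKernel T K)
    {p q : ℝ≥0∞} (hp : p ∈ expRange m) (hq : q ∈ expRange m) {u v : Rn n → 𝕜}
    (hu : MemLp u p volume) (hv : MemLp v q volume) {c : Rn n} {r : ℝ}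
    (hu0 : ∀ y ∈ ball c r, u y = 0) (hv0 : ∀ y ∈ ball c r, v y = 0) :
    ∃ G : Set (Rn n), (∀ᵐ z, z ∈ G) ∧ ∀ z ∈ G ∩ ball c r, ∀ z₀ ∈ G ∩ ball c r,
      ‖(T u z - T v z) - (T u z₀ - T v z₀)‖ₑ ≤
        ∫⁻ y, ‖K z y - K z₀ y‖ₑ * ‖u y - v y‖ₑ := by
  have hp0 : p ≠ 0 := (zero_lt_one.trans (one_lt_of_mem_expRange hm hp)).ne'
  have hq0 : q ≠ 0 := (zero_lt_one.trans (one_lt_of_mem_expRange hm hq)).ne'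
  obtain ⟨Cp, hTp⟩ := hT p hp
  obtain ⟨Cq, hTq⟩ := hT q hq
  let E : ℕ → Set (Rn n) := fun j => {y | ‖y‖ ≤ j} ∩ ({y | ‖u y‖ ≤ j} ∩ {y | ‖v y‖ ≤ j})
  have hE : ∀ j, NullMeasurableSet (E j) volume := fun j =>
    (nullMeasurableSet_le aemeasurable_id.norm aemeasurable_const).inter
      ((nullMeasurableSet_le hu.1.norm.aemeasurable aemeasurable_const).inter
        (nullMeasurableSet_le hv.1.norm.aemeasurable aemeasurable_const))
  have hbdd : ∀ (j : ℕ) (f : Rn n → 𝕜), AEStronglyMeasurable f volume →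
      (∀ y ∈ E j, ‖f y‖ ≤ 2 * j) → IsBddCompact ((E j).indicator f) := by
    intro j f hf hfj
    constructor
    · refine memLp_top_of_bound (hf.indicator₀ (hE j)) (2 * j) (ae_of_all _ fun y => ?_)
      by_cases hy : y ∈ E j
      · rw [indicator_of_mem hy]; exact hfj y hy
      · rw [indicator_of_notMem hy, norm_zero]; positivity
    · refine HasCompactSupport.intro (isCompact_closedBall (0 : Rn n) j) fun y hy => ?_
      refine indicator_of_notMem (fun h => hy ?_) _
      simpa using h.1
  have hlim : ∀ (f : Rn n → 𝕜) y, Tendsto (fun j => (E j).indicator f y) atTop (𝓝 (f y)) := by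
    intro f y
    refine tendsto_const_nhds.congr' ?_
    filter_upwards [eventually_ge_atTop ⌈‖y‖⌉₊, eventually_ge_atTop ⌈‖u y‖⌉₊,
      eventually_ge_atTop ⌈‖v y‖⌉₊] with j h1 h2 h3
    rw [indicator_of_mem]
    exact ⟨Nat.ceil_le.1 h1, Nat.ceil_le.1 h2, Nat.ceil_le.1 h3⟩
  have hub : ∀ j, IsBddCompact ((E j).indicator u) := fun j => hbdd j u hu.1 fun y hy =>
    hy.2.1.trans (by linarith [Nat.cast_nonneg (α := ℝ) j])
  have hvb : ∀ j, IsBddCompact ((E j).indicator v) := fun j => hbdd j v hv.1 fun y hy =>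
    hy.2.2.trans (by linarith [Nat.cast_nonneg (α := ℝ) j])
  have hwb : ∀ j, IsBddCompact ((E j).indicator (u - v)) := fun j =>
    hbdd j (u - v) (hu.1.sub hv.1) fun y hy =>
      (norm_sub_le _ _).trans (by have := hy.2.1; have := hy.2.2; simp only [mem_ofPred_eq] at *; linarith)
  have hTu := hTp.tendstoInMeasure ENNReal.coe_ne_top hp0 hu (fun j => (hub j).memLp p)
    (tendsto_eLpNorm_sub_of_le hp0 hp.2.ne hu (fun j => ((hub j).memLp p).1)
      (fun j y => norm_indicator_le_norm_self _ _) (hlim u))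
  have hTv := hTq.tendstoInMeasure ENNReal.coe_ne_top hq0 hv (fun j => (hvb j).memLp q)
    (tendsto_eLpNorm_sub_of_le hq0 hq.2.ne hv (fun j => ((hvb j).memLp q).1)
      (fun j y => norm_indicator_le_norm_self _ _) (hlim v))
  obtain ⟨ns, -, hu1, hv1⟩ := exists_common_seq_tendsto_ae hTu hTv
  have hsub : ∀ᵐ z, ∀ j, T ((E j).indicator (u - v)) z =
      T ((E j).indicator u) z - T ((E j).indicator v) z := by
    rw [ae_all_iff]
    intro j
    rw [indicator_sub']
    exact hTp.sub ((hub j).memLp p) ((hvb j).memLp p)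
  have hrep : ∀ᵐ z, ∀ j, z ∉ tsupport ((E j).indicator (u - v)) →
      Integrable (fun y => K z y * (E j).indicator (u - v) y) volume ∧
      T ((E j).indicator (u - v)) z = ∫ y, K z y * (E j).indicator (u - v) y := by
    rw [ae_all_iff]
    exact fun j => hTK.repr _ (hwb j)
  -- The ball is open, so vanishing on it keeps its points out of the closed support.
  have hnot : ∀ j, ∀ z ∈ ball c r, z ∉ tsupport ((E j).indicator (u - v)) := by
    intro j z hz
    rw [notMem_tsupport_iff_eventuallyEq]
    filter_upwards [isOpen_ball.mem_nhds hz] with y hy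
    simp [indicator_apply, hu0 y hy, hv0 y hy]
  refine ⟨{z | (∀ j, T ((E j).indicator (u - v)) z =
      T ((E j).indicator u) z - T ((E j).indicator v) z) ∧
      (∀ j, z ∉ tsupport ((E j).indicator (u - v)) →
      Integrable (fun y => K z y * (E j).indicator (u - v) y) volume ∧
      T ((E j).indicator (u - v)) z = ∫ y, K z y * (E j).indicator (u - v) y) ∧
      Tendsto (fun j => T ((E (ns j)).indicator u) z) atTop (𝓝 (T u z)) ∧
      Tendsto (fun j => T ((E (ns j)).indicator v) z) atTop (𝓝 (T v z))}, ?_, ?_⟩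
  · filter_upwards [hsub, hrep, hu1, hv1] with z h1 h2 h3 h4 using ⟨h1, h2, h3, h4⟩
  rintro z ⟨⟨hz1, hz2, hz3, hz4⟩, hzb⟩ z₀ ⟨⟨hy1, hy2, hy3, hy4⟩, hyb⟩
  refine le_of_tendsto ((hz3.sub hz4).sub (hy3.sub hy4)).enorm (Eventually.of_forall fun j => ?_)
  rw [← hz1, ← hy1, (hz2 _ (hnot _ z hzb)).2, (hy2 _ (hnot _ z₀ hyb)).2,
    ← integral_sub (hz2 _ (hnot _ z hzb)).1 (hy2 _ (hnot _ z₀ hyb)).1]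
  refine (enorm_integral_le_lintegral_enorm _).trans (lintegral_mono fun y => ?_)
  dsimp only
  rw [← sub_mul, enorm_mul]
  gcongr
  exact enorm_le_iff_norm_le.2 (norm_indicator_le_norm_self _ _)

end Operator

/-! ### Oscillation against maximal functions, and the far part -/

section PointwiseBound

variable {n : ℕ} {𝕜 : Type*} [RCLike 𝕜]

/-- Telescoping over doublings, each costing `2 ^ n * β`; the first step moves the centre from `c`
to `z`. The linear growth in `k` is what the weight in `HCond` compensates. -/
theorem MeanOscLE.enorm_average_pow_sub_le {b : Rn n → 𝕜} {β : ℝ≥0∞} (hb : MeanOscLE b β)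
    {c z : Rn n} {r : ℝ} (hr : 0 < r) (hz : z ∈ ball c r) (k : ℕ) :
    ‖(⨍ y in ball z (2 ^ k * (2 * r)), b y) - ⨍ y in ball c r, b y‖ₑ ≤
      (k + 1) * (ENNReal.ofReal (2 ^ n) * β) := by
  rw [mem_ball] at hz
  induction k with
  | zero =>
    rw [pow_zero, one_mul, ← enorm_neg, neg_sub]
    simpa using hb.enorm_average_sub_le hr two_pos
      (ball_subset_ball' (x := c) (y := z) (ε₁ := r) (by rw [dist_comm]; linarith))
  | succ k ih =>
    have h1 := hb.enorm_average_sub_le (c := z) (c' := z) (r := 2 ^ k * (2 * r)) (by positivity)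
      two_pos (ball_subset_ball (by
        have : 0 < 2 ^ k * (2 * r) := by positivity
        linarith))
    have h2 : (2 : ℝ) * (2 ^ k * (2 * r)) = 2 ^ (k + 1) * (2 * r) := by ring
    rw [h2] at h1
    rw [← enorm_neg, neg_sub] at h1
    rw [← sub_add_sub_cancel _ (⨍ y in ball z (2 ^ k * (2 * r)), b y)]
    refine (enorm_add_le _ _).trans ((add_le_add h1 ih).trans (le_of_eq ?_))
    push_cast
    ring

theorem setLIntegral_rpow_le_maximalPow {s : ℝ} (hs : 0 < s) (g : Rn n → 𝕜) {x c : Rn n} {r : ℝ}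
    (hx : x ∈ ball c r) :
    (∫⁻ y in ball c r, ‖g y‖ₑ ^ s) ^ (1 / s) ≤
      maximalPow s g x * volume (ball c r) ^ (1 / s) := by
  rw [maximalPow, ← ENNReal.mul_rpow_of_nonneg _ _ (by positivity)]
  gcongr
  exact setLIntegral_ball_le_maximal (fun y => ‖g y‖ₑ ^ s) hx

/-- Hölder's inequality for the product of a function and an oscillation of a `BMO` function. -/
theorem exists_lintegral_oscillation_mul_le [NeZero n] {t s : ℝ} (ht : 1 ≤ t) (hts : t < s) :
    ∃ C : ℝ≥0, ∀ (b : Rn n → 𝕜) (β : ℝ≥0∞), β ≠ 0 → β ≠ ∞ → MeanOscLE b β →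
    ∀ g : Rn n → 𝕜, AEStronglyMeasurable g volume →
    ∀ (c z x : Rn n) (r : ℝ), z ∈ ball c r → x ∈ ball c r → ∀ k : ℕ,
      (∫⁻ y in ball z (2 ^ k * (2 * r)), (‖b y - ⨍ w in ball c r, b w‖ₑ * ‖g y‖ₑ) ^ t) ^ (1 / t) ≤
        C * (k + 1) * β * maximalPow s g x * volume (ball z (2 ^ k * (2 * r))) ^ (1 / t) := by
  have ht0 : 0 < t := by linarith
  have hs0 : 0 < s := by linarith
  -- The Hölder exponent that pairs with `s` to give `t`: the oscillation goes to `L^v`, `g` to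
  -- `L^s`. It exceeds 1, as Minkowski's inequality needs.
  set v : ℝ := (1 / t - 1 / s)⁻¹ with hv
  have hd : 0 < 1 / t - 1 / s := sub_pos.2 (one_div_lt_one_div_of_lt ht0 hts)
  have hv0 : 0 < v := inv_pos.2 hd
  have hvs : 1 / t = 1 / v + 1 / s := by rw [hv, one_div (_⁻¹), inv_inv]; ring
  have htv : t < v := by
    rw [hv, lt_inv_comm₀ ht0 hd, ← one_div]
    have : 0 < 1 / s := by positivity
    linarith
  have hv1 : 1 ≤ v := by linarith
  obtain ⟨C, hC⟩ := exists_lintegral_oscillation_rpow_le (n := n) (𝕜 := 𝕜) hv0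
  refine ⟨C ^ (1 / v) + Real.toNNReal (2 ^ n), fun b β hβ0 hβ hb g hg c z x r hz hx k => ?_⟩
  have hr := pos_of_mem_ball hz
  set B := ball z (2 ^ k * (2 * r)) with hB
  set a := ⨍ w in ball c r, b w with ha
  set a' := ⨍ w in B, b w with ha'
  have hR : 0 < 2 ^ k * (2 * r) := by positivity
  have hxB : x ∈ B := by
    rw [hB, mem_ball]
    rw [mem_ball] at hz hx
    have h1 := dist_triangle_right x z c
    have h2 : (1 : ℝ) ≤ 2 ^ k := one_le_pow₀ (by norm_num)
    nlinarith
  have hbm : AEStronglyMeasurable b (volume.restrict B) := hb.loc.aestronglyMeasurable.restrict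
  have hosc : (∫⁻ y in B, ‖b y - a‖ₑ ^ v) ^ (1 / v) ≤
      (C ^ (1 / v) + Real.toNNReal (2 ^ n) : ℝ≥0) * (k + 1) * β * volume B ^ (1 / v) := by
    calc (∫⁻ y in B, ‖b y - a‖ₑ ^ v) ^ (1 / v)
        ≤ (∫⁻ y in B, (‖b y - a'‖ₑ + ‖a' - a‖ₑ) ^ v) ^ (1 / v) := by
          gcongr with y
          rw [← sub_add_sub_cancel (b y) a' a]
          exact enorm_add_le _ _
      _ ≤ (∫⁻ y in B, ‖b y - a'‖ₑ ^ v) ^ (1 / v) + (∫⁻ _y in B, ‖a' - a‖ₑ ^ v) ^ (1 / v) :=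
          ENNReal.lintegral_Lp_add_le (hbm.sub aestronglyMeasurable_const).enorm
            aemeasurable_const hv1
      _ ≤ (C * β ^ v * volume B) ^ (1 / v) +
          (((k + 1) * (ENNReal.ofReal (2 ^ n) * β)) ^ v * volume B) ^ (1 / v) := by
          gcongr
          · exact hC b β hβ0 hβ hb z _ hR
          · rw [setLIntegral_const]
            gcongr
            exact hb.enorm_average_pow_sub_le hr hz k
      _ = (C ^ (1 / v) * β + (k + 1) * (ENNReal.ofReal (2 ^ n) * β)) * volume B ^ (1 / v) := by
          have h1 : 0 ≤ 1 / v := by positivity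
          rw [ENNReal.mul_rpow_of_nonneg _ _ h1, ENNReal.mul_rpow_of_nonneg _ _ h1,
            ENNReal.mul_rpow_of_nonneg _ _ h1, ← ENNReal.rpow_mul, ← ENNReal.rpow_mul,
            mul_one_div_cancel hv0.ne', ENNReal.rpow_one, ENNReal.rpow_one]
          ring
      _ ≤ _ := by
          gcongr
          rw [ENNReal.coe_add, ENNReal.coe_rpow_of_nonneg _ (by positivity)]
          calc _ = (C : ℝ≥0∞) ^ (1 / v) * 1 * β + ENNReal.ofReal (2 ^ n) * (k + 1) * β := by ring
            _ ≤ (C : ℝ≥0∞) ^ (1 / v) * (k + 1) * β + ENNReal.ofReal (2 ^ n) * (k + 1) * β := by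
                gcongr
                exact le_add_self
            _ = _ := by simp only [ENNReal.ofReal]; ring
  have hH := ENNReal.lintegral_Lp_mul_le_Lq_mul_Lr ht0 htv hvs (volume.restrict B)
    (f := fun y => ‖b y - a‖ₑ) (g := fun y => ‖g y‖ₑ)
    (hbm.sub aestronglyMeasurable_const).enorm hg.enorm.restrict
  refine hH.trans ((mul_le_mul' hosc (setLIntegral_rpow_le_maximalPow hs0 g hxB)).trans
    (le_of_eq ?_))
  have hvol : volume B ^ (1 / t) = volume B ^ (1 / v) * volume B ^ (1 / s) := by
    rw [hvs, ENNReal.rpow_add_of_nonneg _ _ (by positivity) (by positivity)]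
  rw [hvol]
  ring

/-- The contribution to the commutator of the part of the function away from the ball. -/
theorem exists_lintegral_kernel_le [NeZero n] {m : ℝ} (hm : 1 < m) {K : Rn n → Rn n → 𝕜}
    (hKm : ∀ x, AEStronglyMeasurable (K x) volume) (hK : HCond m K) {s : ℝ}
    (hs : m / (m - 1) < s) :
    ∃ C : ℝ≥0, ∀ (b : Rn n → 𝕜) (β : ℝ≥0∞), β ≠ 0 → β ≠ ∞ → MeanOscLE b β →
    ∀ g : Rn n → 𝕜, AEStronglyMeasurable g volume →
    ∀ (c z z₀ x : Rn n) (r : ℝ), z ∈ ball c r → z₀ ∈ ball c r → x ∈ ball c r →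
      ∫⁻ y in (ball c (128 * r))ᶜ,
        ‖K z y - K z₀ y‖ₑ * (‖b y - ⨍ w in ball c r, b w‖ₑ * ‖g y‖ₑ) ≤
        C * β * maximalPow s g x := by
  have hm0 : 0 < m - 1 := by linarith
  set m' := m / (m - 1) with hm'
  have hm'1 : 1 ≤ m' := by rw [hm', le_div_iff₀ hm0]; linarith
  have hconj : m.HolderConjugate m' := Real.HolderConjugate.conjExponent hm
  have hinv : 1 / m' = 1 - 1 / m := by
    rw [hm']; field_simp
  obtain ⟨C₁, hC₁⟩ := exists_lintegral_oscillation_mul_le (n := n) (𝕜 := 𝕜) hm'1 hs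
  obtain ⟨C₂, hC₂⟩ := hK
  set ω : ℝ≥0∞ := volume (ball (0 : Rn n) 1) with hω
  have hωt : ω ≠ ∞ := volume_ball_ne_top _ _
  set D : ℝ≥0∞ := C₁ * 2 * (ENNReal.ofReal (2 ^ n) * ω) ^ (1 / m') with hD
  have hDt : D ≠ ∞ := ENNReal.mul_ne_top (by finiteness)
    (ENNReal.rpow_ne_top_of_nonneg (by positivity) (by finiteness))
  refine ⟨D.toNNReal * C₂, fun b β hβ0 hβ hb g hg c z z₀ x r hz hz₀ hx => ?_⟩
  have hr := pos_of_mem_ball hz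
  set a := ⨍ w in ball c r, b w with ha
  set Φ : Rn n → ℝ≥0∞ := fun y => ‖b y - a‖ₑ * ‖g y‖ₑ with hΦ
  -- Two points of the ball are less than `2 * r` apart. A point outside `ball c (128 * r)` is at
  -- least `127 * r` from `z₀`, hence beyond `2 ^ 5 * l = 64 * r`, where the annuli of `HCond`
  -- begin.
  set l : ℝ := 2 * r with hl
  have hl0 : 0 < l := by positivity
  let R : ℕ → Set (Rn n) := fun k =>
    {y | (2 : ℝ) ^ (k + 5) * l ≤ ‖y - z₀‖ ∧ ‖y - z₀‖ < (2 : ℝ) ^ (k + 5 + 1) * l}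
  have hΦm : AEMeasurable Φ volume :=
    (hb.loc.aestronglyMeasurable.sub aestronglyMeasurable_const).enorm.mul hg.enorm
  have hcover : (ball c (128 * r))ᶜ ⊆ ⋃ k, R k := by
    intro y hy
    have hy : 128 * r ≤ dist y c := not_lt.1 hy
    rw [mem_ball] at hz₀
    have h1 := dist_triangle y z₀ c
    have h2 : 2 ^ 5 * l ≤ ‖y - z₀‖ := by rw [← dist_eq_norm, hl]; linarith
    have h3 : 1 ≤ ‖y - z₀‖ / (2 ^ 5 * l) := by rwa [one_le_div (by positivity)]
    obtain ⟨k, hk1, hk2⟩ := exists_nat_pow_near h3 one_lt_two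
    refine mem_iUnion.2 ⟨k, ?_, ?_⟩
    · rw [le_div_iff₀ (by positivity)] at hk1
      calc _ = 2 ^ k * (2 ^ 5 * l) := by ring
        _ ≤ _ := hk1
    · rw [div_lt_iff₀ (by positivity)] at hk2
      calc _ < 2 ^ (k + 1) * (2 ^ 5 * l) := hk2
        _ = _ := by ring
  have hterm : ∀ k, ∫⁻ y in R k, ‖K z y - K z₀ y‖ₑ * Φ y ≤
      D * β * maximalPow s g x * (((k + 5 : ℕ) : ℝ≥0∞) *
        ENNReal.ofReal (((2 : ℝ) ^ (k + 5) * l) ^ ((n : ℝ) * (1 - 1 / m))) *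
        (∫⁻ y in R k, ‖K z y - K z₀ y‖ₑ ^ m) ^ (1 / m)) := by
    intro k
    have h1 := ENNReal.lintegral_mul_le_Lp_mul_Lq (volume.restrict (R k)) hconj
      (f := fun y => ‖K z y - K z₀ y‖ₑ) (g := Φ)
      ((hKm z).sub (hKm z₀)).enorm.restrict hΦm.restrict
    have h2 : (∫⁻ y in R k, Φ y ^ m') ^ (1 / m') ≤
        (∫⁻ y in ball z₀ (2 ^ (k + 6) * l), Φ y ^ m') ^ (1 / m') := by
      gcongr
      refine fun y hy => ?_
      rw [mem_ball, dist_eq_norm]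
      exact hy.2
    have h3 := hC₁ b β hβ0 hβ hb g hg c z₀ x r hz₀ hx (k + 6)
    have h4 : volume (ball z₀ (2 ^ (k + 6) * l)) ^ (1 / m') =
        (ENNReal.ofReal (2 ^ n) * ω) ^ (1 / m') *
          ENNReal.ofReal (((2 : ℝ) ^ (k + 5) * l) ^ ((n : ℝ) * (1 - 1 / m))) := by
      have h5 : (2 : ℝ) ^ (k + 6) * l = 2 * ((2 ^ (k + 5) * l) * 1) := by ring
      have h6 : 0 < (2 : ℝ) ^ (k + 5) * l := by positivity
      rw [h5, volume_ball_mul z₀ z₀ two_pos, volume_ball_mul z₀ (0 : Rn n) h6, ← hω,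
        mul_left_comm, mul_comm, ENNReal.mul_rpow_of_nonneg _ _ (by positivity)]
      congr 1
      rw [ENNReal.ofReal_rpow_of_nonneg (by positivity) (by positivity), hinv, Real.rpow_mul h6.le,
        Real.rpow_natCast]
    -- The outer radius of the annulus gives drift factor `k + 7`, against the weight `k + 5` in
    -- `HCond`; the loss is the 2 in `D`.
    have h7 : ((k + 6 : ℕ) : ℝ≥0∞) + 1 ≤ 2 * (k + 5 : ℕ) := by
      have : k + 6 + 1 ≤ 2 * (k + 5) := by omega
      exact_mod_cast this
    calc _ ≤ (∫⁻ y in R k, ‖K z y - K z₀ y‖ₑ ^ m) ^ (1 / m) *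
          (C₁ * ((k + 6 : ℕ) + 1) * β * maximalPow s g x *
            volume (ball z₀ (2 ^ (k + 6) * l)) ^ (1 / m')) :=
          h1.trans (mul_le_mul_right (h2.trans h3) _)
      _ ≤ (∫⁻ y in R k, ‖K z y - K z₀ y‖ₑ ^ m) ^ (1 / m) *
          (C₁ * (2 * (k + 5 : ℕ)) * β * maximalPow s g x *
            volume (ball z₀ (2 ^ (k + 6) * l)) ^ (1 / m')) := by gcongr
      _ = _ := by rw [h4, hD]; ring
  have hzz : ‖z - z₀‖ ≤ l := by
    rw [← dist_eq_norm, hl]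
    rw [mem_ball] at hz hz₀
    linarith [dist_triangle_right z z₀ c]
  calc _ ≤ ∫⁻ y in ⋃ k, R k, ‖K z y - K z₀ y‖ₑ * Φ y := lintegral_mono_set hcover
    _ ≤ ∑' k, ∫⁻ y in R k, ‖K z y - K z₀ y‖ₑ * Φ y := lintegral_iUnion_le _ _
    _ ≤ ∑' k, D * β * maximalPow s g x * (((k + 5 : ℕ) : ℝ≥0∞) *
        ENNReal.ofReal (((2 : ℝ) ^ (k + 5) * l) ^ ((n : ℝ) * (1 - 1 / m))) *
        (∫⁻ y in R k, ‖K z y - K z₀ y‖ₑ ^ m) ^ (1 / m)) := ENNReal.tsum_le_tsum hterm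
    _ ≤ D * β * maximalPow s g x * C₂ := by
        rw [ENNReal.tsum_mul_left]
        gcongr
        exact (hC₂ l z z₀ hl0 hzz).le
    _ = _ := by rw [ENNReal.coe_mul, ENNReal.coe_toNNReal hDt]; ring

end PointwiseBound

/-! ### The sharp function of the commutator -/

section SharpBound

variable {n : ℕ} {𝕜 : Type*} [RCLike 𝕜] {T : (Rn n → 𝕜) → (Rn n → 𝕜)}

/-- Hölder on `B` followed by the global `L^t` bound; it serves for the part of the function near
the ball. -/
theorem IsLpBoundedBy.setLIntegral_enorm_le {t : ℝ} (ht : 1 ≤ t) {C : ℝ≥0∞}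
    (hT : IsLpBoundedBy T (ENNReal.ofReal t) C) {w : Rn n → 𝕜}
    (hw : MemLp w (ENNReal.ofReal t) volume) (B : Set (Rn n)) :
    ∫⁻ y in B, ‖T w y‖ₑ ≤
      C * (∫⁻ y, ‖w y‖ₑ ^ t) ^ (1 / t) * volume B ^ (1 - 1 / t) := by
  have ht0 : 0 < t := by linarith
  have h1 := eLpNorm_le_eLpNorm_mul_rpow_measure_univ (μ := volume.restrict B) (p := 1)
    (q := ENNReal.ofReal t) (by rwa [ENNReal.one_le_ofReal]) (hT.memLp w hw).1.restrict
  rw [eLpNorm_one_eq_lintegral_enorm, Measure.restrict_apply_univ, ENNReal.toReal_one,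
    ENNReal.toReal_ofReal ht0.le, div_one] at h1
  refine h1.trans (mul_le_mul_left ?_ _)
  refine (eLpNorm_restrict_le _ _ _ _).trans ((hT.bound w hw).trans (le_of_eq ?_))
  rw [eLpNorm_eq_lintegral_rpow_enorm_toReal (by simpa using ht0) ENNReal.ofReal_ne_top,
    ENNReal.toReal_ofReal ht0.le]

theorem sharp_congr_ae {f g : Rn n → 𝕜} (h : f =ᵐ[volume] g) : sharp f = sharp g := by
  ext x
  refine iSup_congr fun c => iSup_congr fun r => iSup_congr fun _ => ?_
  have h1 : ⨍ z in ball c r, f z = ⨍ z in ball c r, g z := average_congr (ae_restrict_of_ae h)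
  rw [h1]
  exact laverage_congr (ae_restrict_of_ae (h.mono fun y hy => by
    show ‖f y - _‖ₑ = ‖g y - _‖ₑ
    rw [hy]))

/-- With zero oscillation, the averages over the balls of integer radius about the origin all agree,
and `b` equals its average a.e. on each of them. -/
theorem IsBMO.exists_ae_eq_const {b : Rn n → 𝕜} (hb : IsBMO b) (h0 : bmoNorm b = 0) :
    ∃ a : 𝕜, ∀ᵐ x, b x = a := by
  have hb' : MeanOscLE b 0 := hb.meanOscLE h0.le
  have h1 : ∀ k : ℕ, ⨍ z in ball (0 : Rn n) 1, b z = ⨍ z in ball (0 : Rn n) (k + 1), b z := by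
    intro k
    have := hb'.enorm_average_sub_le (c := 0) (c' := 0) one_pos (a := k + 1) (by positivity)
      (ball_subset_ball (by rw [mul_one]; linarith [Nat.cast_nonneg (α := ℝ) k]))
    rw [mul_zero, le_zero_iff, enorm_eq_zero, mul_one] at this
    exact sub_eq_zero.1 this
  refine ⟨⨍ z in ball (0 : Rn n) 1, b z, ?_⟩
  have h2 : ∀ k : ℕ, ∀ᵐ x, x ∈ ball (0 : Rn n) (k + 1) → b x = ⨍ z in ball (0 : Rn n) 1, b z := by
    intro k
    have h3 := hb'.osc 0 (k + 1) (by positivity)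
    have h4 : AEMeasurable (fun y => ‖b y - ⨍ z in ball (0 : Rn n) (k + 1), b z‖ₑ)
        (volume.restrict (ball (0 : Rn n) (k + 1))) :=
      (hb'.loc.aestronglyMeasurable.sub aestronglyMeasurable_const).enorm.restrict
    rw [zero_mul, le_zero_iff, lintegral_eq_zero_iff' h4] at h3
    rw [h1 k, ← ae_restrict_iff' measurableSet_ball]
    filter_upwards [h3] with x hx
    exact sub_eq_zero.1 (enorm_eq_zero.1 hx)
  filter_upwards [ae_all_iff.2 h2] with x hx
  refine hx ⌈‖x‖⌉₊ ?_
  rw [mem_ball_zero_iff]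
  linarith [Nat.le_ceil ‖x‖]

theorem comm_ae_eq_zero {m : ℝ} (hm : 1 < m) (hT : ∀ p ∈ expRange m, IsLpBounded T p)
    {b : Rn n → 𝕜} (hb : IsBMO b) (h0 : bmoNorm b = 0) {f : Rn n → 𝕜} {p : ℝ≥0∞}
    (hp : p ∈ expRange m) (hf : MemLp f p volume) : comm b T f =ᵐ[volume] 0 := by
  obtain ⟨a, ha⟩ := hb.exists_ae_eq_const h0
  obtain ⟨C, hC⟩ := hT p hp
  have hp0 : p ≠ 0 := (zero_lt_one.trans (one_lt_of_mem_expRange hm hp)).ne'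
  have h1 : a • f =ᵐ[volume] b * f := ha.mono fun x hx => by simp [hx]
  filter_upwards [ha, hC.congr_ae hp0 (hf.const_smul a) h1, hC.smul a f hf] with x h1 h2 h3
  simp only [comm, Pi.sub_apply, Pi.mul_apply, Pi.zero_apply]
  rw [← h2, h3, h1]
  simp

theorem min_mem_expRange {m : ℝ} {p q : ℝ≥0∞} (hp : p ∈ expRange m) (hq : q ∈ expRange m) :
    min p q ∈ expRange m :=
  ⟨lt_min hp.1 hq.1, (min_le_left _ _).trans_lt hp.2⟩

/-- The three-term splitting of the commutator on one ball. The constant `a` found is minus the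
value of the far term at a good point of the ball. -/
theorem exists_lintegral_comm_sub_le [NeZero n] {m : ℝ} (hm : 1 < m) {K : Rn n → Rn n → 𝕜}
    (hT : ∀ p ∈ expRange m, IsLpBounded T p) (hTK : HasKernel T K) (hK : HCond m K)
    {s : ℝ} (hs : m / (m - 1) < s) :
    ∃ C : ℝ≥0, ∀ (b : Rn n → 𝕜) (β : ℝ≥0∞), β ≠ 0 → β ≠ ∞ → MeanOscLE b β →
    ∀ (f : Rn n → 𝕜) (p q : ℝ≥0∞), p ∈ expRange m → q ∈ expRange m → MemLp f p volume →
    MemLp (b * f) q volume → ∀ x : Rn n, maximalPow s f x ≠ ∞ → ∀ c r, x ∈ ball c r →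
    ∃ a : 𝕜, ∫⁻ y in ball c r, ‖comm b T f y - a‖ₑ ≤
      C * β * (maximalPow s (T f) x + maximalPow s f x) * volume (ball c r) := by
  have hm'1 : 1 < m / (m - 1) := by rw [lt_div_iff₀ (by linarith)]; linarith
  -- Above `m'`, so that `T` is bounded on `L^t`, and below `s`, so that Hölder leaves room for the
  -- oscillation of `b`.
  set t : ℝ := (m / (m - 1) + s) / 2 with ht
  have ht1 : 1 < t := by rw [ht]; linarith
  have ht0 : 0 < t := by linarith
  have hts : t < s := by rw [ht]; linarith
  have htmem : ENNReal.ofReal t ∈ expRange m :=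
    ⟨by rw [ENNReal.ofReal_lt_ofReal_iff ht0, ht]; linarith, ENNReal.ofReal_lt_top⟩
  obtain ⟨C₁, hC₁⟩ := exists_lintegral_oscillation_mul_le (n := n) (𝕜 := 𝕜) le_rfl
    (show (1 : ℝ) < s by linarith)
  obtain ⟨C₂, hC₂⟩ := exists_lintegral_oscillation_mul_le (n := n) (𝕜 := 𝕜) ht1.le hts
  obtain ⟨C₃, hC₃⟩ := exists_lintegral_kernel_le hm hTK.meas hK hs
  obtain ⟨Ct, hCt⟩ := hT _ htmem
  refine ⟨C₁ * Real.toNNReal (2 ^ n) + Ct * (C₂ * 7) * Real.toNNReal (128 ^ n) ^ (1 / t) + C₃,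
    fun b β hβ0 hβ hb f p q hp hq hf hbf x hfin c r hx => ?_⟩
  have hr := pos_of_mem_ball hx
  have hc : c ∈ ball c r := mem_ball_self hr
  obtain ⟨Cp, hCp⟩ := hT p hp
  obtain ⟨Cq, hCq⟩ := hT q hq
  obtain ⟨C₀, hC₀⟩ := hT _ (min_mem_expRange hp hq)
  set B := ball c r with hB
  set B' := ball c (128 * r) with hB'
  have hBm : MeasurableSet B' := measurableSet_ball
  have hBB : B ⊆ B' := ball_subset_ball (by linarith)
  set a := ⨍ w in B, b w with ha
  set F₁ := B'.indicator f with hF₁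
  set F₂ := B'ᶜ.indicator f with hF₂
  set G₁ := B'.indicator (b * f) with hG₁
  set G₂ := B'ᶜ.indicator (b * f) with hG₂
  have hF₁p : MemLp F₁ p volume := hf.indicator hBm
  have hF₂p : MemLp F₂ p volume := hf.indicator hBm.compl
  have hG₁q : MemLp G₁ q volume := hbf.indicator hBm
  have hG₂q : MemLp G₂ q volume := hbf.indicator hBm.compl
  have hF₁0 : MemLp F₁ (min p q) volume := hF₁p.mono_exponent_of_measure_support_ne_top
    (s := B') (fun y hy => indicator_of_notMem hy _) (volume_ball_ne_top _ _) (min_le_left _ _)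
  have hG₁0 : MemLp G₁ (min p q) volume := hG₁q.mono_exponent_of_measure_support_ne_top
    (s := B') (fun y hy => indicator_of_notMem hy _) (volume_ball_ne_top _ _) (min_le_right _ _)
  set w := G₁ - a • F₁ with hw
  have hwnorm : ∀ y, ‖w y‖ₑ ^ t = B'.indicator (fun y => (‖b y - a‖ₑ * ‖f y‖ₑ) ^ t) y := by
    intro y
    by_cases hy : y ∈ B'
    · simp only [hw, hG₁, hF₁, Pi.sub_apply, Pi.smul_apply, indicator_of_mem hy, Pi.mul_apply,
        smul_eq_mul]
      rw [← sub_mul, enorm_mul]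
    · simp only [hw, hG₁, hF₁, Pi.sub_apply, Pi.smul_apply, indicator_of_notMem hy]
      simp [ht0]
  -- Six doublings from `2 * r` reach `128 * r`; this is the source of the factor `7 = 6 + 1`.
  have hB'eq : B' = ball c (2 ^ 6 * (2 * r)) := by rw [hB']; congr 1; ring
  have hwint : (∫⁻ y, ‖w y‖ₑ ^ t) ^ (1 / t) ≤
      C₂ * 7 * β * maximalPow s f x * volume B' ^ (1 / t) := by
    simp_rw [hwnorm]
    rw [lintegral_indicator hBm]
    have := hC₂ b β hβ0 hβ hb f hf.1 c c x r hc hx 6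
    rw [← hB'eq] at this
    norm_num at this ⊢
    exact this
  have hwt : MemLp w (ENNReal.ofReal t) volume := by
    refine ⟨(hG₁q.1.sub (hF₁p.1.const_smul a)), ?_⟩
    rw [eLpNorm_eq_lintegral_rpow_enorm_toReal (by simpa using ht0) ENNReal.ofReal_ne_top,
      ENNReal.toReal_ofReal ht0.le]
    refine hwint.trans_lt (ENNReal.mul_lt_top (by finiteness) ?_)
    exact ENNReal.rpow_lt_top_of_nonneg (by positivity) (volume_ball_ne_top _ _)
  have hI : ∫⁻ y in B, ‖(b y - a) * T f y‖ₑ ≤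
      C₁ * ENNReal.ofReal (2 ^ n) * β * maximalPow s (T f) x * volume B := by
    have h := hC₁ b β hβ0 hβ hb (T f) (hCp.memLp f hf).1 c c x r hc hx 0
    simp only [ENNReal.rpow_one, pow_zero, one_mul, one_div, inv_one, CharP.cast_eq_zero, zero_add,
      mul_one] at h
    rw [volume_ball_mul c c two_pos] at h
    calc _ ≤ ∫⁻ y in ball c (2 * r), ‖b y - a‖ₑ * ‖T f y‖ₑ := by
          simp_rw [enorm_mul]
          exact lintegral_mono_set (ball_subset_ball (by linarith))
      _ ≤ _ := h
      _ = _ := by ring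
  have hII : ∫⁻ y in B, ‖T w y‖ₑ ≤
      Ct * (C₂ * 7) * ENNReal.ofReal (128 ^ n) ^ (1 / t) * β * maximalPow s f x * volume B := by
    have h1t : 1 / t ≤ 1 := by rw [div_le_one ht0]; exact ht1.le
    refine (hCt.setLIntegral_enorm_le ht1.le hwt B).trans ?_
    calc _ ≤ Ct * (C₂ * 7 * β * maximalPow s f x * volume B' ^ (1 / t)) *
          volume B ^ (1 - 1 / t) := by gcongr
      _ = Ct * (C₂ * 7) * ENNReal.ofReal (128 ^ n) ^ (1 / t) * β * maximalPow s f x *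
          (volume B ^ (1 / t) * volume B ^ (1 - 1 / t)) := by
          rw [hB', volume_ball_mul c c (by norm_num : (0 : ℝ) < 128),
            ENNReal.mul_rpow_of_nonneg _ _ (by positivity)]
          ring
      _ = _ := by
          rw [← ENNReal.rpow_add_of_nonneg _ _ (by positivity) (by linarith), add_sub_cancel,
            ENNReal.rpow_one]
  obtain ⟨G, hG, hGb⟩ := exists_ae_kernel_bound hm hT hTK hq hp (u := G₂) (v := a • F₂) hG₂q
    (hF₂p.const_smul a) (c := c) (r := r)
    (fun y hy => indicator_of_notMem (notMem_compl_iff.2 (hBB hy)) _)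
    (fun y hy => by
      rw [Pi.smul_apply, hF₂, indicator_of_notMem (notMem_compl_iff.2 (hBB hy)), smul_zero])
  have hIII : ∀ z ∈ G ∩ B, ∀ z₀ ∈ G ∩ B,
      ‖(T G₂ z - T (a • F₂) z) - (T G₂ z₀ - T (a • F₂) z₀)‖ₑ ≤ C₃ * β * maximalPow s f x := by
    intro z hz z₀ hz₀
    refine (hGb z hz z₀ hz₀).trans ?_
    refine le_trans (le_of_eq ?_) (hC₃ b β hβ0 hβ hb f hf.1 c z z₀ x r hz.2 hz₀.2 hx)
    rw [← lintegral_indicator hBm.compl]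
    refine lintegral_congr fun y => ?_
    by_cases hy : y ∈ B'ᶜ
    · simp only [hG₂, hF₂, Pi.smul_apply, indicator_of_mem hy, Pi.mul_apply, smul_eq_mul]
      rw [← sub_mul, enorm_mul]
    · simp [hG₂, hF₂, indicator_of_notMem hy]
  obtain ⟨z₀, hz₀B, hz₀G⟩ : ∃ z₀ ∈ B, z₀ ∈ G := by
    by_contra! h
    exact volume_ball_ne_zero c hr (measure_mono_null (fun y hy => h y hy) hG)
  set h₀ := T G₂ z₀ - T (a • F₂) z₀ with hh₀
  refine ⟨-h₀, ?_⟩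
  have hdecomp : ∀ᵐ z, comm b T f z =
      (b z - a) * T f z - T w z - (T G₂ z - T (a • F₂) z) := by
    have e1 := hCq.add G₁ G₂ hG₁q hG₂q
    rw [hG₁, hG₂, indicator_self_add_compl, ← hG₁, ← hG₂] at e1
    have e2 := hCp.add (a • F₁) (a • F₂) (hF₁p.const_smul a) (hF₂p.const_smul a)
    rw [← smul_add, hF₁, hF₂, indicator_self_add_compl, ← hF₁, ← hF₂] at e2
    have e3 := hC₀.sub hG₁0 (hF₁0.const_smul a)
    filter_upwards [e1, e2, e3, hCp.smul a f hf] with z h1 h2 h3 h4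
    rw [h4] at h2
    simp only [comm, Pi.sub_apply, Pi.mul_apply, Pi.add_apply, Pi.smul_apply, smul_eq_mul] at *
    rw [h1, h3]
    linear_combination h2
  have hmeas1 : AEMeasurable (fun z => ‖(b z - a) * T f z‖ₑ) (volume.restrict B) :=
    (((hb.loc.aestronglyMeasurable.sub aestronglyMeasurable_const).mul
      (hCp.memLp f hf).1).enorm).restrict
  calc ∫⁻ y in B, ‖comm b T f y - -h₀‖ₑ
      ≤ ∫⁻ y in B, (‖(b y - a) * T f y‖ₑ + (‖T w y‖ₑ + C₃ * β * maximalPow s f x)) := by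
        refine lintegral_mono_ae ?_
        rw [ae_restrict_iff' measurableSet_ball]
        filter_upwards [hdecomp, hG] with z hz hzG hzB
        rw [hz]
        have e : (b z - a) * T f z - T w z - (T G₂ z - T (a • F₂) z) - -h₀ =
            (b z - a) * T f z - (T w z + ((T G₂ z - T (a • F₂) z) - h₀)) := by ring
        rw [e]
        refine enorm_sub_le.trans (add_le_add le_rfl ((enorm_add_le _ _).trans ?_))
        exact add_le_add le_rfl (hIII z ⟨hzG, hzB⟩ z₀ ⟨hz₀G, hz₀B⟩)
    _ = (∫⁻ y in B, ‖(b y - a) * T f y‖ₑ) + ((∫⁻ y in B, ‖T w y‖ₑ) +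
        C₃ * β * maximalPow s f x * volume B) := by
        rw [lintegral_add_left' hmeas1, lintegral_add_right _ measurable_const, setLIntegral_const]
    _ ≤ C₁ * ENNReal.ofReal (2 ^ n) * β * maximalPow s (T f) x * volume B +
        (Ct * (C₂ * 7) * ENNReal.ofReal (128 ^ n) ^ (1 / t) * β * maximalPow s f x * volume B +
          C₃ * β * maximalPow s f x * volume B) := by gcongr
    _ = (C₁ * ENNReal.ofReal (2 ^ n) * maximalPow s (T f) x +
        (Ct * (C₂ * 7) * ENNReal.ofReal (128 ^ n) ^ (1 / t) + C₃) * maximalPow s f x) *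
        (β * volume B) := by ring
    _ ≤ ((C₁ * ENNReal.ofReal (2 ^ n) + Ct * (C₂ * 7) * ENNReal.ofReal (128 ^ n) ^ (1 / t) + C₃) *
        maximalPow s (T f) x +
        (C₁ * ENNReal.ofReal (2 ^ n) + Ct * (C₂ * 7) * ENNReal.ofReal (128 ^ n) ^ (1 / t) + C₃) *
          maximalPow s f x) * (β * volume B) := by
        gcongr (?_ * _ + ?_ * _) * _
        · rw [add_assoc]; exact le_self_add
        · rw [add_assoc]; exact le_add_self
    _ = _ := by
        push_cast
        rw [ENNReal.coe_rpow_of_nonneg _ (by positivity)]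
        simp only [ENNReal.ofReal]
        ring

/-- The pointwise bound for the sharp function of the commutator. -/
theorem exists_sharp_comm_le [NeZero n] {m : ℝ} (hm : 1 < m) {K : Rn n → Rn n → 𝕜}
    (hT : ∀ p ∈ expRange m, IsLpBounded T p) (hTK : HasKernel T K) (hK : HCond m K)
    {s : ℝ} (hs : m / (m - 1) < s) :
    ∃ C : ℝ≥0, ∀ b : Rn n → 𝕜, IsBMO b → ∀ f : Rn n → 𝕜,
      (∃ p ∈ expRange m, MemLp f p volume) → (∃ q ∈ expRange m, MemLp (b * f) q volume) →
      ∀ x : Rn n, sharp (comm b T f) x ≤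
        C * bmoNorm b * (maximalPow s (T f) x + maximalPow s f x) := by
  obtain ⟨C, hC⟩ := exists_lintegral_comm_sub_le hm hT hTK hK hs
  -- The 2 replaces an arbitrary constant by the average. The 1 keeps the constant positive, so that
  -- the right side is infinite when a maximal function is and `bmoNorm b ≠ 0`.
  refine ⟨2 * C + 1, ?_⟩
  rintro b hb f ⟨p, hp, hf⟩ ⟨q, hq, hbf⟩ x
  by_cases h0 : bmoNorm b = 0
  · rw [sharp_congr_ae (comm_ae_eq_zero hm hT hb h0 hp hf)]
    refine le_trans (sharp_le_of_forall_ball fun c r _ => ?_) zero_le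
    simp [average_eq]
  by_cases hM : maximalPow s (T f) x + maximalPow s f x = ∞
  · rw [hM, ENNReal.mul_top (mul_ne_zero (by simp) h0)]
    exact le_top
  refine sharp_le_of_forall_ball fun c r hx => ?_
  obtain ⟨a, ha⟩ := hC b (bmoNorm b) h0 hb.2.ne (hb.meanOscLE le_rfl) f p q hp hq hf hbf x
    (ENNReal.add_ne_top.1 hM).2 c r hx
  obtain ⟨Cp, hCp⟩ := hT p hp
  obtain ⟨Cq, hCq⟩ := hT q hq
  have hmeas : AEStronglyMeasurable (comm b T f) volume :=
    (hb.1.aestronglyMeasurable.mul (hCp.memLp f hf).1).sub (hCq.memLp _ hbf).1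
  have hfin : ∫⁻ y in ball c r, ‖comm b T f y - a‖ₑ < ∞ := by
    refine ha.trans_lt (ENNReal.mul_lt_top (ENNReal.mul_lt_top
      (ENNReal.mul_lt_top ENNReal.coe_lt_top hb.2) (lt_top_iff_ne_top.2 hM)) measure_ball_lt_top)
  have hintegrable : IntegrableOn (comm b T f) (ball c r) volume := by
    have h1 : IntegrableOn (fun y => comm b T f y - a) (ball c r) volume :=
      ⟨(hmeas.sub aestronglyMeasurable_const).restrict, hfin⟩
    have h2 := h1.add (integrableOn_const (volume_ball_ne_top c r) (C := a))
    refine h2.congr (ae_of_all _ fun y => ?_)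
    simp
  refine (setLIntegral_sub_setAverage_le (pos_of_mem_ball hx) hintegrable a).trans ?_
  calc _ ≤ 2 * (C * bmoNorm b * (maximalPow s (T f) x + maximalPow s f x) * volume (ball c r)) := by
        gcongr
    _ = (2 * C) * bmoNorm b * (maximalPow s (T f) x + maximalPow s f x) * volume (ball c r) := by
        ring
    _ ≤ _ := by
        gcongr
        push_cast
        exact le_self_add

end SharpBound

/-! ### Lipschitz truncation of BMO functions -/

section Truncation

variable {n : ℕ} {𝕜 : Type*} [RCLike 𝕜]

/-- A smooth truncation at height `N`. -/
noncomputable def truncAt (N : ℝ) (u : 𝕜) : 𝕜 := (1 + ‖u‖ / N)⁻¹ • u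

theorem norm_truncAt {N : ℝ} (hN : 0 < N) (u : 𝕜) : ‖truncAt N u‖ = (1 + ‖u‖ / N)⁻¹ * ‖u‖ := by
  have : 0 ≤ (1 + ‖u‖ / N)⁻¹ := by positivity
  rw [truncAt, norm_smul, Real.norm_of_nonneg this]

theorem norm_truncAt_le {N : ℝ} (hN : 0 < N) (u : 𝕜) : ‖truncAt N u‖ ≤ ‖u‖ := by
  rw [norm_truncAt hN]
  refine mul_le_of_le_one_left (norm_nonneg _) (inv_le_one_of_one_le₀ ?_)
  have : 0 ≤ ‖u‖ / N := by positivity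
  linarith

theorem norm_truncAt_le_height {N : ℝ} (hN : 0 < N) (u : 𝕜) : ‖truncAt N u‖ ≤ N := by
  rw [norm_truncAt hN, inv_mul_le_iff₀ (by positivity), add_mul, div_mul_cancel₀ _ hN.ne']
  linarith

/-- The difference splits into `u - v` scaled by a factor at most 1, and `v` times a difference of
the scalar factors; the latter is at most `‖u - v‖` because `‖v‖ / N` is at most `1 + ‖v‖ / N`. -/
theorem norm_truncAt_sub_le {N : ℝ} (hN : 0 < N) (u v : 𝕜) :
    ‖truncAt N u - truncAt N v‖ ≤ 2 * ‖u - v‖ := by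
  set x := 1 + ‖u‖ / N with hx
  set y := 1 + ‖v‖ / N with hy
  have hx1 : 1 ≤ x := by rw [hx]; have : 0 ≤ ‖u‖ / N := by positivity
                         linarith
  have hy1 : 1 ≤ y := by rw [hy]; have : 0 ≤ ‖v‖ / N := by positivity
                         linarith
  have hx0 : 0 < x := by linarith
  have hy0 : 0 < y := by linarith
  have e : truncAt N u - truncAt N v = x⁻¹ • (u - v) + (x⁻¹ - y⁻¹) • v := by
    simp only [truncAt, ← hx, ← hy, smul_sub, sub_smul]
    abel
  have h1 : ‖x⁻¹ - y⁻¹‖ * ‖v‖ ≤ ‖u - v‖ := by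
    have h2 : x⁻¹ - y⁻¹ = (‖v‖ - ‖u‖) / N * (x⁻¹ * y⁻¹) := by
      have : y - x = (‖v‖ - ‖u‖) / N := by rw [hx, hy]; ring
      rw [← this]
      field_simp
    have h3 : |‖v‖ - ‖u‖| ≤ ‖u - v‖ := by
      rw [← norm_neg (u - v), neg_sub]; exact abs_norm_sub_norm_le v u
    have h4 : ‖v‖ / N * y⁻¹ ≤ 1 := by
      rw [← div_eq_mul_inv, div_le_one hy0, hy]; linarith
    have h5 : x⁻¹ ≤ 1 := inv_le_one_of_one_le₀ hx1
    have h6 : 0 ≤ ‖v‖ / N * y⁻¹ := by positivity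
    rw [h2, Real.norm_eq_abs, abs_mul, abs_div, abs_of_pos hN,
      abs_of_pos (show 0 < x⁻¹ * y⁻¹ by positivity)]
    calc _ = |‖v‖ - ‖u‖| * (x⁻¹ * (‖v‖ / N * y⁻¹)) := by ring
      _ ≤ ‖u - v‖ * (1 * 1) := by gcongr
      _ = _ := by ring
  rw [e]
  refine (norm_add_le _ _).trans ?_
  rw [norm_smul, norm_smul, two_mul]
  refine add_le_add ?_ h1
  rw [Real.norm_of_nonneg (by positivity)]
  exact mul_le_of_le_one_left (norm_nonneg _) (inv_le_one_of_one_le₀ hx1)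

theorem continuous_truncAt {N : ℝ} (hN : 0 < N) : Continuous (truncAt N : 𝕜 → 𝕜) := by
  unfold truncAt
  refine Continuous.smul (Continuous.inv₀ (by fun_prop) fun u => ?_) continuous_id
  positivity

theorem tendsto_truncAt (u : 𝕜) :
    Tendsto (fun j : ℕ => truncAt ((j : ℝ) + 1) u) atTop (𝓝 u) := by
  have h1 : Tendsto (fun j : ℕ => ‖u‖ / ((j : ℝ) + 1)) atTop (𝓝 0) :=
    tendsto_const_nhds.div_atTop (tendsto_natCast_atTop_atTop.atTop_add tendsto_const_nhds)
  have h2 : Tendsto (fun j : ℕ => (1 + ‖u‖ / ((j : ℝ) + 1))⁻¹) atTop (𝓝 1) := by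
    simpa using (h1.const_add 1).inv₀ (by norm_num)
  simpa [truncAt] using h2.smul_const u

/-- One factor 2 is the Lipschitz constant, the other the passage from the constant `truncAt N a` to
the average. The height `N` plays no part in the bound. -/
theorem MeanOscLE.truncAt {b : Rn n → 𝕜} {β : ℝ≥0∞} (hb : MeanOscLE b β) {N : ℝ} (hN : 0 < N) :
    MeanOscLE (fun x => truncAt N (b x)) (4 * β) := by
  have hloc : LocallyIntegrable (fun x => CommutatorBMO.truncAt N (b x)) volume :=
    hb.loc.mono ((continuous_truncAt hN).comp_aestronglyMeasurable hb.loc.aestronglyMeasurable)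
      (ae_of_all _ fun x => norm_truncAt_le hN _)
  refine ⟨hloc, fun c r hr => ?_⟩
  set a := ⨍ z in ball c r, b z
  calc _ ≤ 2 * ∫⁻ y in ball c r, ‖CommutatorBMO.truncAt N (b y) - CommutatorBMO.truncAt N a‖ₑ :=
        setLIntegral_sub_setAverage_le hr (integrableOn_ball hloc c r) _
    _ ≤ 2 * ∫⁻ y in ball c r, 2 * ‖b y - a‖ₑ := by
        gcongr with y
        rw [← ofReal_norm, ← ofReal_norm, ← ENNReal.ofReal_ofNat 2,
          ← ENNReal.ofReal_mul (by norm_num)]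
        exact ENNReal.ofReal_le_ofReal (norm_truncAt_sub_le hN _ _)
    _ = 4 * ∫⁻ y in ball c r, ‖b y - a‖ₑ := by
        rw [lintegral_const_mul' _ _ (by simp), ← mul_assoc]; norm_num
    _ ≤ 4 * (β * volume (ball c r)) := by gcongr; exact hb.osc c r hr
    _ = _ := by ring

end Truncation

/-! ### The `L^p` bound on the natural domain -/

section Boundedness

variable {n : ℕ} {𝕜 : Type*} [RCLike 𝕜] {T : (Rn n → 𝕜) → (Rn n → 𝕜)}

theorem memLp_of_lintegral_rpow {p : ℝ≥0∞} (hp0 : p ≠ 0) (hp : p ≠ ∞) {f : Rn n → 𝕜}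
    {μ : Measure (Rn n)} (hf : AEStronglyMeasurable f μ)
    (h : ∫⁻ x, ‖f x‖ₑ ^ p.toReal ∂μ < ∞) : MemLp f p μ := by
  refine ⟨hf, ?_⟩
  rw [eLpNorm_eq_lintegral_rpow_enorm_toReal hp0 hp]
  exact ENNReal.rpow_lt_top_of_nonneg (by positivity) h.ne

/-- The product of a `BMO` function with a bounded function of compact support is in all `L^q`. -/
theorem IsBMO.memLp_mul [NeZero n] {b f : Rn n → 𝕜} (hb : IsBMO b) (hf : IsBddCompact f)
    {q : ℝ≥0∞} (hq0 : q ≠ 0) (hq : q ≠ ∞) : MemLp (b * f) q volume := by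
  obtain ⟨R, hR0, hR⟩ : ∃ R : ℝ, 0 < R ∧ tsupport f ⊆ ball 0 R := by
    obtain ⟨R, hR⟩ := hf.2.isCompact.isBounded.subset_ball (0 : Rn n)
    exact ⟨max R 1, by positivity, hR.trans (ball_subset_ball (le_max_left _ _))⟩
  obtain ⟨C, hC⟩ := exists_lintegral_oscillation_rpow_le (n := n) (𝕜 := 𝕜)
    (ENNReal.toReal_pos hq0 hq)
  -- Adding 1 meets the requirement `β ≠ 0` when `b` is a.e. constant; only finiteness is wanted
  -- here.
  have hβ : bmoNorm b + 1 ≠ ∞ := ENNReal.add_ne_top.2 ⟨hb.2.ne, by simp⟩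
  have h1 := hC b (bmoNorm b + 1) (by simp) hβ (hb.meanOscLE le_self_add) 0 R hR0
  set B := ball (0 : Rn n) R
  set a := ⨍ z in B, b z
  have : IsFiniteMeasure (volume.restrict B) := ⟨by
    rw [Measure.restrict_apply_univ]; exact measure_ball_lt_top⟩
  have h2 : MemLp (fun x => b x - a) q (volume.restrict B) := by
    refine memLp_of_lintegral_rpow hq0 hq
      (hb.1.aestronglyMeasurable.sub aestronglyMeasurable_const).restrict (h1.trans_lt ?_)
    refine ENNReal.mul_lt_top (ENNReal.mul_lt_top ENNReal.coe_lt_top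
      (ENNReal.rpow_lt_top_of_nonneg (by positivity) hβ)) measure_ball_lt_top
  have h3 : MemLp b q (volume.restrict B) := by
    have := h2.add (memLp_const a)
    refine this.ae_eq (ae_of_all _ fun x => ?_)
    simp
  have h4 : MemLp (b * f) q (volume.restrict B) := (hf.1.restrict B).mul h3
  rw [← memLp_indicator_iff_restrict measurableSet_ball] at h4
  convert h4 using 1
  refine (indicator_eq_self.2 fun x hx => hR (subset_tsupport f ?_)).symm
  intro h
  exact hx (by simp [h])

theorem maximalPow_rpow {s p : ℝ} (f : Rn n → 𝕜) (x : Rn n) :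
    maximalPow s f x ^ p = maximal (fun y => ‖f y‖ₑ ^ s) x ^ (p / s) := by
  rw [maximalPow, ← ENNReal.rpow_mul]
  congr 1
  ring

theorem measurable_maximalPow {s : ℝ} (f : Rn n → 𝕜) : Measurable (maximalPow s f) :=
  (measurable_maximal _).pow_const _

theorem exists_lintegral_maximalPow_le [NeZero n] {s p : ℝ} (hs : 0 < s) (hsp : s < p) :
    ∃ C : ℝ≥0, ∀ f : Rn n → 𝕜, AEStronglyMeasurable f volume →
      (∫⁻ x, maximalPow s f x ^ p) ^ (1 / p) ≤ C * (∫⁻ x, ‖f x‖ₑ ^ p) ^ (1 / p) := by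
  have hp : 0 < p := hs.trans hsp
  obtain ⟨C, hC⟩ := exists_lintegral_maximal_rpow_le (n := n) (p := p / s)
    (by rwa [one_lt_div hs])
  refine ⟨C ^ (1 / p), fun f hf => ?_⟩
  rw [ENNReal.coe_rpow_of_nonneg _ (by positivity),
    ← ENNReal.mul_rpow_of_nonneg _ _ (by positivity)]
  gcongr
  simp_rw [maximalPow_rpow]
  refine (hC _ (hf.enorm.pow_const s)).trans (le_of_eq ?_)
  simp_rw [← ENNReal.rpow_mul, mul_div_cancel₀ p hs.ne']

theorem memLp_bounded_mul {p : ℝ≥0∞} {b f : Rn n → 𝕜} (hb : AEStronglyMeasurable b volume) {N : ℝ}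
    (hN : ∀ x, ‖b x‖ ≤ N) (hf : MemLp f p volume) : MemLp (b * f) p volume :=
  hf.of_le_mul (c := N) (hb.mul hf.1) (ae_of_all _ fun x => by
    rw [Pi.mul_apply, norm_mul]
    exact mul_le_mul_of_nonneg_right (hN x) (norm_nonneg _))

/-- The commutator with a bounded function. -/
theorem exists_eLpNorm_comm_le_of_bounded [NeZero n] {m : ℝ} (hm : 1 < m) {K : Rn n → Rn n → 𝕜}
    (hT : ∀ p ∈ expRange m, IsLpBounded T p) (hTK : HasKernel T K) (hK : HCond m K)
    {p : ℝ≥0∞} (hp : p ∈ expRange m) :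
    ∃ C : ℝ≥0, ∀ b : Rn n → 𝕜, IsBMO b → ∀ N : ℝ, (∀ x, ‖b x‖ ≤ N) →
      ∀ f : Rn n → 𝕜, MemLp f p volume →
      eLpNorm (comm b T f) p volume ≤ C * bmoNorm b * eLpNorm f p volume := by
  have hm'1 : 1 < m / (m - 1) := by rw [lt_div_iff₀ (by linarith)]; linarith
  have hp1 := one_lt_of_mem_expRange hm hp
  have hp0 : p ≠ 0 := (zero_lt_one.trans hp1).ne'
  have hpt : p ≠ ∞ := hp.2.ne
  set P := p.toReal with hP
  have hP1 : m / (m - 1) < P := (ENNReal.ofReal_lt_iff_lt_toReal (by linarith) hpt).1 hp.1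
  have hP0 : 0 < P := by linarith
  set s := (m / (m - 1) + P) / 2 with hs
  obtain ⟨C₁, hC₁⟩ := exists_lintegral_rpow_le_sharp (n := n) (𝕜 := 𝕜) (p := P) (by linarith)
  obtain ⟨C₂, hC₂⟩ := exists_sharp_comm_le hm hT hTK hK (s := s) (by rw [hs]; linarith)
  obtain ⟨C₃, hC₃⟩ := exists_lintegral_maximalPow_le (n := n) (𝕜 := 𝕜) (s := s) (p := P)
    (by rw [hs]; linarith) (by rw [hs]; linarith)
  obtain ⟨Cp, hCp⟩ := hT p hp
  refine ⟨C₁ ^ (1 / P) * C₂ * C₃ * (Cp + 1), fun b hb N hN f hf => ?_⟩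
  have hbf : MemLp (b * f) p volume := memLp_bounded_mul hb.1.aestronglyMeasurable hN hf
  have hTf := hCp.memLp f hf
  -- The sole use of boundedness of `b`: the a priori membership that Fefferman-Stein needs. The
  -- final constant is free of `N`.
  have hg : MemLp (comm b T f) p volume :=
    (memLp_bounded_mul hb.1.aestronglyMeasurable hN hTf).sub (hCp.memLp _ hbf)
  have hFS := hC₁ (comm b T f) (hg.locallyIntegrable hp1.le) hg.1 (by
    rw [hP, ← eLpNorm_rpow_toReal hp0 hpt]
    exact ENNReal.rpow_ne_top_of_nonneg hP0.le hg.2.ne)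
  have hLp : ∀ h : Rn n → 𝕜, eLpNorm h p volume = (∫⁻ x, ‖h x‖ₑ ^ P) ^ (1 / P) := fun h =>
    eLpNorm_eq_lintegral_rpow_enorm_toReal hp0 hpt
  have hCb : (C₂ : ℝ≥0∞) * bmoNorm b ≠ ∞ := ENNReal.mul_ne_top ENNReal.coe_ne_top hb.2.ne
  calc eLpNorm (comm b T f) p volume = (∫⁻ x, ‖comm b T f x‖ₑ ^ P) ^ (1 / P) := hLp _
    _ ≤ (C₁ * ∫⁻ x, sharp (comm b T f) x ^ P) ^ (1 / P) := by gcongr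
    _ ≤ (C₁ * ∫⁻ x, (C₂ * bmoNorm b * (maximalPow s (T f) x + maximalPow s f x)) ^ P) ^
        (1 / P) := by
        gcongr with x
        exact hC₂ b hb f ⟨p, hp, hf⟩ ⟨p, hp, hbf⟩ x
    _ = C₁ ^ (1 / P) * (C₂ * bmoNorm b) *
        (∫⁻ x, (maximalPow s (T f) x + maximalPow s f x) ^ P) ^ (1 / P) := by
        simp_rw [ENNReal.mul_rpow_of_nonneg _ _ hP0.le]
        rw [lintegral_const_mul' _ _ (by
            rw [← ENNReal.mul_rpow_of_nonneg _ _ hP0.le]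
            exact ENNReal.rpow_ne_top_of_nonneg hP0.le hCb),
          ← ENNReal.mul_rpow_of_nonneg _ _ hP0.le, ENNReal.mul_rpow_of_nonneg _ _ (by positivity),
          ENNReal.mul_rpow_of_nonneg _ _ (by positivity), ← ENNReal.rpow_mul (C₂ * bmoNorm b),
          mul_one_div_cancel hP0.ne', ENNReal.rpow_one]
        ring
    _ ≤ C₁ ^ (1 / P) * (C₂ * bmoNorm b) * ((∫⁻ x, maximalPow s (T f) x ^ P) ^ (1 / P) +
        (∫⁻ x, maximalPow s f x ^ P) ^ (1 / P)) := by
        gcongr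
        exact ENNReal.lintegral_Lp_add_le (measurable_maximalPow _).aemeasurable
          (measurable_maximalPow _).aemeasurable (by linarith)
    _ ≤ C₁ ^ (1 / P) * (C₂ * bmoNorm b) * (C₃ * (Cp * eLpNorm f p volume) +
        C₃ * eLpNorm f p volume) := by
        gcongr
        · refine (hC₃ _ hTf.1).trans ?_
          rw [← hLp]
          gcongr
          exact hCp.bound f hf
        · rw [hLp]
          exact hC₃ _ hf.1
    _ = _ := by
        push_cast
        rw [ENNReal.coe_rpow_of_nonneg _ (by positivity)]
        ring

/-- The commutator bound on its natural domain in `L^p`. -/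
theorem exists_eLpNorm_comm_le [NeZero n] {m : ℝ} (hm : 1 < m) {K : Rn n → Rn n → 𝕜}
    (hT : ∀ p ∈ expRange m, IsLpBounded T p) (hTK : HasKernel T K) (hK : HCond m K)
    {p : ℝ≥0∞} (hp : p ∈ expRange m) :
    ∃ C : ℝ≥0, ∀ b : Rn n → 𝕜, IsBMO b → ∀ f : Rn n → 𝕜, MemLp f p volume →
      (∃ q ∈ expRange m, MemLp (b * f) q volume) →
      MemLp (comm b T f) p volume ∧
      eLpNorm (comm b T f) p volume ≤ C * bmoNorm b * eLpNorm f p volume := by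
  obtain ⟨C, hC⟩ := exists_eLpNorm_comm_le_of_bounded hm hT hTK hK hp
  refine ⟨4 * C, ?_⟩
  rintro b hb f hf ⟨q, hq, hbf⟩
  have hq0 : q ≠ 0 := (zero_lt_one.trans (one_lt_of_mem_expRange hm hq)).ne'
  obtain ⟨Cp, hCp⟩ := hT p hp
  obtain ⟨Cq, hCq⟩ := hT q hq
  let β : ℕ → Rn n → 𝕜 := fun j x => truncAt ((j : ℝ) + 1) (b x)
  have hpos : ∀ j : ℕ, 0 < (j : ℝ) + 1 := fun j => by positivity
  have hosc : ∀ j, MeanOscLE (β j) (4 * bmoNorm b) := fun j =>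
    (hb.meanOscLE le_rfl).truncAt (hpos j)
  have hnorm : ∀ j, bmoNorm (β j) ≤ 4 * bmoNorm b := fun j => bmoNorm_le_of_meanOscLE (hosc j)
  have hbmo : ∀ j, IsBMO (β j) := fun j =>
    ⟨(hosc j).loc, (hnorm j).trans_lt (ENNReal.mul_lt_top (by simp) hb.2)⟩
  have hβm : ∀ j, AEStronglyMeasurable (β j) volume := fun j => (hosc j).loc.aestronglyMeasurable
  have hle : ∀ j x, ‖(β j * f) x‖ ≤ ‖(b * f) x‖ := fun j x => by
    simp only [Pi.mul_apply, norm_mul]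
    gcongr
    exact norm_truncAt_le (hpos j) _
  have hβfq : ∀ j, MemLp (β j * f) q volume := fun j =>
    hbf.mono ((hβm j).mul hf.1) (ae_of_all _ (hle j))
  have hβfp : ∀ j, MemLp (β j * f) p volume := fun j =>
    memLp_bounded_mul (hβm j) (fun x => norm_truncAt_le_height (hpos j) _) hf
  have hTm : ∀ j, AEStronglyMeasurable (comm (β j) T f) volume := fun j =>
    ((hβm j).mul (hCp.memLp f hf).1).sub (hCp.memLp _ (hβfp j)).1
  -- Convergence takes place in `L^q`, where `b * f` lives, whereas the bound that passes to the
  -- limit by Fatou is in `L^p`.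
  have hmeas := hCq.tendstoInMeasure ENNReal.coe_ne_top hq0 hbf hβfq
    (tendsto_eLpNorm_sub_of_le hq0 hq.2.ne hbf (fun j => (hβfq j).1) hle
      fun x => (tendsto_truncAt (b x)).mul_const (f x))
  obtain ⟨ns, hmono, hns⟩ := hmeas.exists_seq_tendsto_ae
  have hlim : ∀ᵐ x, Tendsto (fun j => comm (β (ns j)) T f x) atTop (𝓝 (comm b T f x)) := by
    filter_upwards [hns] with x hx
    exact (((tendsto_truncAt (b x)).comp hmono.tendsto_atTop).mul_const (T f x)).sub hx
  have hbound : eLpNorm (comm b T f) p volume ≤ (4 * C : ℝ≥0) * bmoNorm b * eLpNorm f p volume := by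
    refine (Lp.eLpNorm_lim_le_liminf_eLpNorm (fun j => hTm (ns j)) _ hlim).trans ?_
    refine liminf_le_of_le (by isBoundedDefault) fun y hy => ?_
    obtain ⟨j, hj⟩ := hy.exists
    refine hj.trans ((hC _ (hbmo _) _ (fun x => norm_truncAt_le_height (hpos _) _) f hf).trans ?_)
    calc _ ≤ C * (4 * bmoNorm b) * eLpNorm f p volume := by
          gcongr
          exact hnorm _
      _ = _ := by push_cast; ring
  exact ⟨⟨(hb.1.aestronglyMeasurable.mul (hCp.memLp f hf).1).sub (hCq.memLp _ hbf).1,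
    hbound.trans_lt (ENNReal.mul_lt_top (ENNReal.mul_lt_top ENNReal.coe_lt_top hb.2) hf.2)⟩, hbound⟩

end Boundedness

/-! ### Extension of the commutator to all of `L^p` -/

section Extension

variable {n : ℕ} {𝕜 : Type*} [RCLike 𝕜] {T : (Rn n → 𝕜) → (Rn n → 𝕜)}

theorem exists_tendsto_eLpNorm_of_le {p : ℝ≥0∞} (hp : 1 ≤ p) {g : ℕ → Rn n → 𝕜}
    (hg : ∀ j, MemLp (g j) p volume) {e : ℕ → ℝ≥0∞} (he : Tendsto e atTop (𝓝 0))
    (h : ∀ i j, eLpNorm (g i - g j) p volume ≤ e i + e j) :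
    ∃ u : Rn n → 𝕜, MemLp u p volume ∧ Tendsto (fun j => eLpNorm (g j - u) p volume) atTop (𝓝 0) := by
  have : Fact (1 ≤ p) := ⟨hp⟩
  have hc : CauchySeq fun j => (hg j).toLp (g j) := by
    rw [EMetric.cauchySeq_iff]
    intro ε hε
    have hε2 : 0 < ε / 2 := ENNReal.half_pos hε.ne'
    obtain ⟨N, hN⟩ := eventually_atTop.1 (he.eventually (gt_mem_nhds hε2))
    refine ⟨N, fun i hi j hj => ?_⟩
    rw [Lp.edist_toLp_toLp]
    calc _ ≤ e i + e j := h i j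
      _ < ε / 2 + ε / 2 := ENNReal.add_lt_add (hN i hi) (hN j hj)
      _ = ε := ENNReal.add_halves ε
  obtain ⟨u, hu⟩ := cauchySeq_tendsto_of_complete hc
  refine ⟨u, Lp.memLp u, ?_⟩
  have h1 : (Lp.memLp u).toLp u = u := Lp.toLp_coeFn u _
  rw [← h1] at hu
  exact (Lp.tendsto_Lp_iff_tendsto_eLpNorm'' g hg u (Lp.memLp u)).1 hu

theorem ae_eq_of_tendsto_eLpNorm {p : ℝ≥0∞} (hp : 1 ≤ p) {g : ℕ → Rn n → 𝕜} {u v : Rn n → 𝕜}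
    (hg : ∀ j, AEStronglyMeasurable (g j) volume) (hu : AEStronglyMeasurable u volume)
    (hv : AEStronglyMeasurable v volume)
    (h1 : Tendsto (fun j => eLpNorm (g j - u) p volume) atTop (𝓝 0))
    (h2 : Tendsto (fun j => eLpNorm (g j - v) p volume) atTop (𝓝 0)) : u =ᵐ[volume] v := by
  have h3 : eLpNorm (u - v) p volume = 0 := by
    rw [← le_zero_iff]
    have h4 := h1.add h2
    rw [add_zero] at h4
    refine ge_of_tendsto h4 (Eventually.of_forall fun j => ?_)
    have e : u - v = (g j - v) - (g j - u) := by abel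
    rw [e, add_comm]
    exact eLpNorm_sub_le ((hg j).sub hv) ((hg j).sub hu) hp
  rw [eLpNorm_eq_zero_iff (hu.sub hv) (zero_lt_one.trans_le hp).ne'] at h3
  exact h3.mono fun x hx => sub_eq_zero.1 hx

theorem comm_add_ae {p q Cp Cq : ℝ≥0∞} (hTp : IsLpBoundedBy T p Cp) (hTq : IsLpBoundedBy T q Cq)
    {b f g : Rn n → 𝕜} (hf : MemLp f p volume) (hg : MemLp g p volume)
    (hbf : MemLp (b * f) q volume) (hbg : MemLp (b * g) q volume) :
    comm b T (f + g) =ᵐ[volume] comm b T f + comm b T g := by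
  have h1 := hTq.add _ _ hbf hbg
  rw [← mul_add] at h1
  filter_upwards [hTp.add f g hf hg, h1] with x h1 h2
  simp only [comm, Pi.sub_apply, Pi.mul_apply, Pi.add_apply] at *
  rw [h1, h2]
  ring

theorem comm_sub_ae {p q Cp Cq : ℝ≥0∞} (hTp : IsLpBoundedBy T p Cp) (hTq : IsLpBoundedBy T q Cq)
    {b f g : Rn n → 𝕜} (hf : MemLp f p volume) (hg : MemLp g p volume)
    (hbf : MemLp (b * f) q volume) (hbg : MemLp (b * g) q volume) :
    comm b T (f - g) =ᵐ[volume] comm b T f - comm b T g := by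
  have h1 := hTq.sub hbf hbg
  rw [← mul_sub] at h1
  filter_upwards [hTp.sub hf hg, h1] with x h1 h2
  simp only [comm, Pi.sub_apply, Pi.mul_apply] at *
  rw [h1, h2]
  ring

theorem comm_smul_ae {p q Cp Cq : ℝ≥0∞} (hTp : IsLpBoundedBy T p Cp) (hTq : IsLpBoundedBy T q Cq)
    {b f : Rn n → 𝕜} (a : 𝕜) (hf : MemLp f p volume) (hbf : MemLp (b * f) q volume) :
    comm b T (a • f) =ᵐ[volume] a • comm b T f := by
  have h1 := hTq.smul a _ hbf
  rw [← mul_smul_comm] at h1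
  filter_upwards [hTp.smul a f hf, h1] with x h1 h2
  simp only [comm, Pi.sub_apply, Pi.mul_apply, Pi.smul_apply, smul_eq_mul] at *
  rw [h1, h2]
  ring

/-- An operator that is bounded on the functions `f` of `L^p` with `b f` in `L^p` extends
to `L^p`. -/
theorem exists_comm_extension {p : ℝ≥0∞} (hp1 : 1 ≤ p) (hp : p ≠ ∞) {Cp : ℝ≥0∞}
    (hTp : IsLpBoundedBy T p Cp) {b : Rn n → 𝕜} (hb : AEStronglyMeasurable b volume) {D : ℝ≥0∞}
    (hD : D ≠ ∞) (hbound : ∀ f : Rn n → 𝕜, MemLp f p volume → MemLp (b * f) p volume →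
      MemLp (comm b T f) p volume ∧
      eLpNorm (comm b T f) p volume ≤ D * eLpNorm f p volume) :
    ∃ S : (Rn n → 𝕜) → (Rn n → 𝕜), IsLpBoundedBy S p D ∧
      ∀ f : Rn n → 𝕜, MemLp f p volume → Tendsto (fun j : ℕ =>
        eLpNorm (comm b T ({x | ‖b x‖ ≤ j}.indicator f) - S f) p volume) atTop (𝓝 0) := by
  have hp0 : p ≠ 0 := (zero_lt_one.trans_le hp1).ne'
  -- Cutting `f` to `A j` puts `b * f` into `L^p`, so every `f` in `L^p` is a limit of functions on
  -- which the commutator is already bounded.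
  let A : ℕ → Set (Rn n) := fun j => {x | ‖b x‖ ≤ j}
  have hA : ∀ j, NullMeasurableSet (A j) volume := fun j =>
    nullMeasurableSet_le hb.norm.aemeasurable aemeasurable_const
  have hlim : ∀ (f : Rn n → 𝕜) x, Tendsto (fun j => (A j).indicator f x) atTop (𝓝 (f x)) := by
    intro f x
    refine tendsto_const_nhds.congr' ?_
    filter_upwards [eventually_ge_atTop ⌈‖b x‖⌉₊] with j hj
    rw [indicator_of_mem]
    exact Nat.ceil_le.1 hj
  have hmem : ∀ f : Rn n → 𝕜, MemLp f p volume → ∀ j, MemLp ((A j).indicator f) p volume :=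
    fun f hf j => hf.mono (hf.1.indicator₀ (hA j))
      (ae_of_all _ fun x => norm_indicator_le_norm_self _ _)
  have hbmem : ∀ f : Rn n → 𝕜, MemLp f p volume → ∀ j,
      MemLp (b * (A j).indicator f) p volume := fun f hf j =>
    hf.of_le_mul (c := j) (hb.mul (hmem f hf j).1) (ae_of_all _ fun x => by
      by_cases hx : x ∈ A j
      · rw [Pi.mul_apply, indicator_of_mem hx, norm_mul]
        exact mul_le_mul_of_nonneg_right hx (norm_nonneg _)
      · rw [Pi.mul_apply, indicator_of_notMem hx, mul_zero, norm_zero]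
        positivity)
  have hconv : ∀ f : Rn n → 𝕜, MemLp f p volume →
      Tendsto (fun j => D * eLpNorm ((A j).indicator f - f) p volume) atTop (𝓝 0) := by
    intro f hf
    have h1 := tendsto_eLpNorm_sub_of_le hp0 hp hf (fun j => (hmem f hf j).1)
      (fun j x => norm_indicator_le_norm_self _ _) (hlim f)
    simpa using ENNReal.Tendsto.const_mul h1 (Or.inr hD)
  have hU : ∀ f : Rn n → 𝕜, MemLp f p volume → ∀ j,
      MemLp (comm b T ((A j).indicator f)) p volume := fun f hf j =>
    (hbound _ (hmem f hf j) (hbmem f hf j)).1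
  have hex : ∀ f : Rn n → 𝕜, MemLp f p volume → ∃ u : Rn n → 𝕜, MemLp u p volume ∧
      Tendsto (fun j => eLpNorm (comm b T ((A j).indicator f) - u) p volume) atTop (𝓝 0) := by
    intro f hf
    refine exists_tendsto_eLpNorm_of_le hp1 (hU f hf) (hconv f hf) fun i j => ?_
    have e : b * ((A i).indicator f - (A j).indicator f) =
      b * (A i).indicator f - b * (A j).indicator f := mul_sub _ _ _
    have h2 := (hbound ((A i).indicator f - (A j).indicator f)
      ((hmem f hf i).sub (hmem f hf j)) (e ▸ (hbmem f hf i).sub (hbmem f hf j))).2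
    rw [eLpNorm_congr_ae (comm_sub_ae hTp hTp (hmem f hf i) (hmem f hf j) (hbmem f hf i)
      (hbmem f hf j))] at h2
    refine h2.trans ?_
    rw [← mul_add]
    gcongr
    have e2 : (A i).indicator f - (A j).indicator f =
      ((A i).indicator f - f) - ((A j).indicator f - f) := by abel
    rw [e2]
    exact eLpNorm_sub_le ((hmem f hf i).sub hf).1 ((hmem f hf j).sub hf).1 hp1
  choose! S hSmem hSlim using hex
  refine ⟨S, ⟨fun f g hf hg => ?_, fun a f hf => ?_, hSmem, fun f hf => ?_⟩, hSlim⟩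
  · refine ae_eq_of_tendsto_eLpNorm hp1 (fun j => (hU _ (hf.add hg) j).1) (hSmem _ (hf.add hg)).1
      ((hSmem f hf).add (hSmem g hg)).1 (hSlim _ (hf.add hg)) ?_
    have h1 := (hSlim f hf).add (hSlim g hg)
    rw [add_zero] at h1
    refine tendsto_of_tendsto_of_tendsto_of_le_of_le tendsto_const_nhds h1 (fun _ => zero_le)
      fun j => ?_
    have h2 := comm_add_ae hTp hTp (hmem f hf j) (hmem g hg j) (hbmem f hf j) (hbmem g hg j)
    rw [← indicator_add'] at h2
    dsimp only
    rw [eLpNorm_congr_ae (h2.sub (ae_eq_refl (S f + S g)))]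
    rw [add_sub_add_comm]
    exact eLpNorm_add_le ((hU f hf j).sub (hSmem f hf)).1 ((hU g hg j).sub (hSmem g hg)).1 hp1
  · refine ae_eq_of_tendsto_eLpNorm hp1 (fun j => (hU _ (hf.const_smul a) j).1)
      (hSmem _ (hf.const_smul a)).1 ((hSmem f hf).const_smul a).1 (hSlim _ (hf.const_smul a)) ?_
    have h1 := ENNReal.Tendsto.const_mul (hSlim f hf) (Or.inr (enorm_ne_top (x := a)))
    rw [mul_zero] at h1
    refine h1.congr fun j => ?_
    have h2 := comm_smul_ae hTp hTp a (hmem f hf j) (hbmem f hf j)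
    have e : a • (A j).indicator f = (A j).indicator (a • f) :=
      (indicator_const_smul (A j) a f).symm
    rw [e] at h2
    rw [eLpNorm_congr_ae (h2.sub (ae_eq_refl (a • S f))), ← smul_sub, eLpNorm_const_smul]
  · have h1 := (hSlim f hf).add_const (D * eLpNorm f p volume)
    rw [zero_add] at h1
    refine ge_of_tendsto h1 (Eventually.of_forall fun j => ?_)
    have e : S f = comm b T ((A j).indicator f) - (comm b T ((A j).indicator f) - S f) := by abel
    calc eLpNorm (S f) p volume ≤ eLpNorm (comm b T ((A j).indicator f)) p volume +
          eLpNorm (comm b T ((A j).indicator f) - S f) p volume := by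
          nth_rw 1 [e]
          exact eLpNorm_sub_le (hU f hf j).1 ((hU f hf j).sub (hSmem f hf)).1 hp1
      _ ≤ D * eLpNorm f p volume + eLpNorm (comm b T ((A j).indicator f) - S f) p volume := by
          gcongr
          refine (hbound _ (hmem f hf j) (hbmem f hf j)).2.trans ?_
          gcongr
          exact eLpNorm_mono fun x => norm_indicator_le_norm_self _ _
      _ = _ := add_comm _ _

/-- The commutator with a `BMO` function extends to a bounded operator on `L^p`. -/
theorem exists_comm_isLpBoundedBy [NeZero n] {m : ℝ} (hm : 1 < m) {K : Rn n → Rn n → 𝕜}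
    (hT : ∀ p ∈ expRange m, IsLpBounded T p) (hTK : HasKernel T K) (hK : HCond m K)
    {p : ℝ≥0∞} (hp : p ∈ expRange m) :
    ∃ C : ℝ≥0, ∀ b : Rn n → 𝕜, IsBMO b →
      ∃ S : (Rn n → 𝕜) → (Rn n → 𝕜), IsLpBoundedBy S p (C * bmoNorm b) ∧
        ∀ f : Rn n → 𝕜, MemLp f p volume → (∃ q ∈ expRange m, MemLp (b * f) q volume) →
          S f =ᵐ[volume] comm b T f := by
  obtain ⟨C, hC⟩ := exists_eLpNorm_comm_le hm hT hTK hK hp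
  obtain ⟨Cp, hCp⟩ := hT p hp
  have hp1 := (one_lt_of_mem_expRange hm hp).le
  have hp0 : p ≠ 0 := (zero_lt_one.trans_le hp1).ne'
  refine ⟨C, fun b hb => ?_⟩
  have hbm := hb.1.aestronglyMeasurable
  have hD : (C : ℝ≥0∞) * bmoNorm b ≠ ∞ := ENNReal.mul_ne_top ENNReal.coe_ne_top hb.2.ne
  obtain ⟨S, hS, hSlim⟩ := exists_comm_extension hp1 hp.2.ne hCp hbm hD
    fun f hf hbf => hC b hb f hf ⟨p, hp, hbf⟩
  refine ⟨S, hS, ?_⟩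
  rintro f hf ⟨q, hq, hbf⟩
  obtain ⟨Cq, hCq⟩ := hT q hq
  let A : ℕ → Set (Rn n) := fun j => {x | ‖b x‖ ≤ j}
  have hA : ∀ j, NullMeasurableSet (A j) volume := fun j =>
    nullMeasurableSet_le hbm.norm.aemeasurable aemeasurable_const
  have hfj : ∀ j, MemLp ((A j).indicator f) p volume := fun j =>
    hf.mono (hf.1.indicator₀ (hA j)) (ae_of_all _ fun x => norm_indicator_le_norm_self _ _)
  have hbfj : ∀ j, MemLp (b * (A j).indicator f) q volume := fun j =>
    hbf.mono (hbm.mul (hfj j).1) (ae_of_all _ fun x => by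
      rw [Pi.mul_apply, Pi.mul_apply, norm_mul, norm_mul]
      gcongr
      exact norm_indicator_le_norm_self _ _)
  -- The cut-offs have commutators tending to `S f` by construction and to `comm b T f` by the bound
  -- applied to their differences from `f`. That bound is needed for the exponent `q`, as `b * f`
  -- need not be in `L^p`.
  refine ae_eq_of_tendsto_eLpNorm hp1 (fun j => (hC b hb _ (hfj j) ⟨q, hq, hbfj j⟩).1.1)
    (hS.memLp f hf).1 (hC b hb f hf ⟨q, hq, hbf⟩).1.1 (hSlim f hf) ?_
  have h1 := tendsto_eLpNorm_sub_of_le hp0 hp.2.ne hf (fun j => (hfj j).1)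
    (fun j x => norm_indicator_le_norm_self _ _) (fun x => by
      refine tendsto_const_nhds.congr' ?_
      filter_upwards [eventually_ge_atTop ⌈‖b x‖⌉₊] with j hj
      rw [indicator_of_mem]
      exact Nat.ceil_le.1 hj)
  have h2 := ENNReal.Tendsto.const_mul h1 (Or.inr hD)
  rw [mul_zero] at h2
  refine tendsto_of_tendsto_of_tendsto_of_le_of_le tendsto_const_nhds h2 (fun _ => zero_le)
    fun j => ?_
  dsimp only
  rw [eLpNorm_congr_ae (comm_sub_ae hCp hCq (hfj j) hf (hbfj j) hbf).symm]
  have e : b * ((A j).indicator f - f) = b * (A j).indicator f - b * f := mul_sub _ _ _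
  exact (hC b hb _ ((hfj j).sub hf) ⟨q, hq, e ▸ (hbfj j).sub hbf⟩).2

end Extension

end CommutatorBMO

theorem proposition1 {𝕜 : Type*} [RCLike 𝕜] (n : ℕ) (hn : 1 ≤ n) (m : ℝ) (hm : 1 < m)
    (T : (CommutatorBMO.Rn n → 𝕜) → (CommutatorBMO.Rn n → 𝕜))
    (K : CommutatorBMO.Rn n → CommutatorBMO.Rn n → 𝕜)
    (hT : ∀ p ∈ CommutatorBMO.expRange m, CommutatorBMO.IsLpBounded T p)
    (hTK : CommutatorBMO.HasKernel T K)
    (hK : CommutatorBMO.HCond m K) :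
    -- `b f` lies in the domain of `T` for all `f` in the dense class of bounded functions with
    -- compact support
    (∀ b : CommutatorBMO.Rn n → 𝕜, CommutatorBMO.IsBMO b →
      ∀ f : CommutatorBMO.Rn n → 𝕜, CommutatorBMO.IsBddCompact f →
        ∀ q ∈ CommutatorBMO.expRange m, MemLp (b * f) q volume) ∧
    -- boundedness of the commutator on `L^p`, with the bound for its norm
    (∀ p ∈ CommutatorBMO.expRange m, ∃ C : ℝ≥0,
      ∀ b : CommutatorBMO.Rn n → 𝕜, CommutatorBMO.IsBMO b →
        ∃ S : (CommutatorBMO.Rn n → 𝕜) → (CommutatorBMO.Rn n → 𝕜),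
          CommutatorBMO.IsLpBoundedBy S p (C * CommutatorBMO.bmoNorm b) ∧
          ∀ f : CommutatorBMO.Rn n → 𝕜, MemLp f p volume →
            (∃ q ∈ CommutatorBMO.expRange m, MemLp (b * f) q volume) →
            S f =ᵐ[volume] CommutatorBMO.comm b T f) ∧
    -- the pointwise bound for the sharp function of the commutator
    (∀ s : ℝ, m / (m - 1) < s → ∃ C : ℝ≥0,
      ∀ b : CommutatorBMO.Rn n → 𝕜, CommutatorBMO.IsBMO b →
        ∀ f : CommutatorBMO.Rn n → 𝕜,
          (∃ p ∈ CommutatorBMO.expRange m, MemLp f p volume) →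
          (∃ q ∈ CommutatorBMO.expRange m, MemLp (b * f) q volume) →
          ∀ x : CommutatorBMO.Rn n,
            CommutatorBMO.sharp (CommutatorBMO.comm b T f) x ≤
              C * CommutatorBMO.bmoNorm b *
                (CommutatorBMO.maximalPow s (T f) x + CommutatorBMO.maximalPow s f x)) := by
  have : NeZero n := ⟨by omega⟩
  refine ⟨fun b hb f hf q hq => ?_, fun p hp => ?_, fun s hs => ?_⟩
  · exact hb.memLp_mul hf (zero_lt_one.trans (CommutatorBMO.one_lt_of_mem_expRange hm hq)).ne'
      hq.2.ne
  · exact CommutatorBMO.exists_comm_isLpBoundedBy hm hT hTK hK hp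
  · exact CommutatorBMO.exists_sharp_comm_le hm hT hTK hK hs
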